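/- Let $a_1,a_2>0$ and, for $j\in\{1,2\}$, let $\chi_j\in C^2(-a_j,a_j)\cap C^1[-a_j,a_j]$ be real-valued with $\chi_j(0)=0$. Let $\Omega\subset[-a_1,a_1]\times[-a_2,a_2]$ be an open set which together with any point $(x,y)$ contains the closed rectangle with vertices $(\pm x,\pm y)$ (such a set is star-shaped about the origin, hence, if non-empty, a simply connected domain). Let $\chi(x_1,x_2)=\chi_1(x_1)+\chi_2(x_2)$ be the (separable) superpotential. *Hamiltonians.* Put $q_i^{\pm}=\mp\partial_i+\partial_i\chi$ and $p_i^{\pm}=\sum_{k=1}^2\epsilon_{ik}q_k^{\mp}$, where $\epsilon_{12}=1=-\epsilon_{21}$, $\epsilon_{11}=\epsilon_{22}=0$, and $$H^{(0)}=\sum_k q_k^+q_k^-=-\Delta+\sum_k\big((\partial_k\chi)^2-\partial_k^2\chi\big),\qquad H^{(2)}=\sum_k p_k^+p_k^-=-\Delta+\sum_k\big((\partial_k\chi)^2+\partial_k^2\chi\big),$$ $$H=\mathrm{diag}(H^{(0)},H^{(2)}),\qquad H^{(1)}=\big(H^{(1)}_{ij}\big)_{i,j=1}^2,\quad H^{(1)}_{ij}=q_i^-q_j^++p_i^-p_j^+=\delta_{ij}H^{(0)}+2\partial_i\partial_j\chi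 .$$ For complex-valued $w$ put $Pw=(\operatorname{Im}w,\operatorname{Re}w)^\top$. *Transmutation operators.* Put $q_j=\chi_j''+(\chi_j')^2$ on $(-a_j,a_j)$ and $h_j=(\mathrm e^{\chi_j})'(0)$. Let $K_j(x,t)$, $|x|,|t|<a_j$, be the unique $C^1$ solution of the Goursat problem $$\big(\partial_x^2-q_j(x)\big)K_j(x,t)=\partial_t^2K_j(x,t),\qquad K_j(x,x)=\tfrac12\int_0^xq_j(s)\,\mathrm ds,\qquad K_j(x,-x)=0,$$ where the equation is understood in characteristic coordinates, i.e. $\partial_u\partial_v\big[K_j(u+v,u-v)\big]=q_j(u+v)K_j(u+v,u-v)$. Put $$\mathbf K_j(x,t;h_j)=\frac{h_j}2+K_j(x,t)+\frac{h_j}2\int_t^x\big[K_j(x,s)-K_j(x,-s)\big]\mathrm ds,$$ $$\widetilde{\mathbf K}_j(x,t;-h_j)=-\mathrm e^{-\chi_j(x)}\Big(\int_{-t}^x\partial_t\mathbf K_j(s,t;h_j)\,\mathrm e^{\chi_j(s)}\,\mathrm ds+\frac{h_j}2\mathrm e^{\chi_j(-t)}\Big),$$ $$T_jf(x)=f(x)+\int_{-x}^x\mathbf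 K_j(x,t;h_j)f(t)\,\mathrm dt,\qquad \widetilde T_jf(x)=f(x)+\int_{-x}^x\widetilde{\mathbf K}_j(x,t;-h_j)f(t)\,\mathrm dt .$$ On functions of $(x_1,x_2)$, the operators $T_j,\widetilde T_j$ act in the variable $x_j$. Put $$\mathbf T_0w=T_1T_2\operatorname{Re}w+\mathrm i\,\widetilde T_1\widetilde T_2\operatorname{Im}w,\qquad \mathbf T_1w=\widetilde T_1T_2\operatorname{Re}w+\mathrm i\,T_1\widetilde T_2\operatorname{Im}w .$$ **Claim.** For every complex-valued $w\in C^2(\Omega)$ the functions $\mathbf T_0w$ and $\mathbf T_1w$ belong to $C^2(\Omega)$, and in $\Omega$ $$HP\mathbf T_0w=-P\mathbf T_0\Delta w\qquad\text{and}\qquad H^{(1)}P\mathbf T_1w=-P\mathbf T_1\Delta w .$$ -/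

import Mathlib

open Set MeasureTheory

noncomputable section

namespace SUSY

/-! ### Partial derivatives and the Laplacian in the plane `ℝ × ℝ` -/

/-- The partial derivative `∂₁` (index `0`) or `∂₂` (index `1`). -/
def partialD {E : Type*} [NormedAddCommGroup E] [NormedSpace ℝ E]
    (i : Fin 2) (f : ℝ × ℝ → E) (p : ℝ × ℝ) : E :=
  if i = 0 then deriv (fun s : ℝ => f (s, p.2)) p.1 else deriv (fun s : ℝ => f (p.1, s)) p.2

/-- The Laplacian `Δ = ∂₁² + ∂₂²`. -/
def laplace {E : Type*} [NormedAddCommGroup E] [NormedSpace ℝ E]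
    (f : ℝ × ℝ → E) (p : ℝ × ℝ) : E :=
  ∑ k : Fin 2, partialD k (partialD k f) p

/-! ### The components of the supercharges and the superhamiltonian -/

/-- `q_i^+ = -∂_i + ∂_i χ`. -/
def qPlus (χ : ℝ × ℝ → ℝ) (i : Fin 2) (f : ℝ × ℝ → ℝ) (p : ℝ × ℝ) : ℝ :=
  -partialD i f p + partialD i χ p * f p

/-- `q_i^- = ∂_i + ∂_i χ`. -/
def qMinus (χ : ℝ × ℝ → ℝ) (i : Fin 2) (f : ℝ × ℝ → ℝ) (p : ℝ × ℝ) : ℝ :=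
  partialD i f p + partialD i χ p * f p

/-- The fundamental antisymmetric tensor, `ε₁₂ = 1 = -ε₂₁`. -/
def eps : Matrix (Fin 2) (Fin 2) ℝ := !![0, 1; -1, 0]

/-- `p_i^+ = ∑_k ε_{ik} q_k^-`. -/
def pPlus (χ : ℝ × ℝ → ℝ) (i : Fin 2) (f : ℝ × ℝ → ℝ) (p : ℝ × ℝ) : ℝ :=
  ∑ k : Fin 2, eps i k * qMinus χ k f p

/-- `p_i^- = ∑_k ε_{ik} q_k^+`. -/
def pMinus (χ : ℝ × ℝ → ℝ) (i : Fin 2) (f : ℝ × ℝ → ℝ) (p : ℝ × ℝ) : ℝ :=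
  ∑ k : Fin 2, eps i k * qPlus χ k f p

/-- The scalar Hamiltonian `H⁽⁰⁾ = ∑_k q_k^+ q_k^-`, that is, on `C²` functions,
`-Δ + ∑_k ((∂_k χ)² - ∂_k² χ)`. -/
def H0 (χ : ℝ × ℝ → ℝ) (f : ℝ × ℝ → ℝ) (p : ℝ × ℝ) : ℝ :=
  ∑ k : Fin 2, qPlus χ k (qMinus χ k f) p

/-- The scalar Hamiltonian `H⁽²⁾ = ∑_k p_k^+ p_k^-`, that is, on `C²` functions,
`-Δ + ∑_k ((∂_k χ)² + ∂_k² χ)`. -/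
def H2 (χ : ℝ × ℝ → ℝ) (f : ℝ × ℝ → ℝ) (p : ℝ × ℝ) : ℝ :=
  ∑ k : Fin 2, pPlus χ k (pMinus χ k f) p

/-- The diagonal operator `H = diag (H⁽⁰⁾, H⁽²⁾)`. -/
def H (χ : ℝ × ℝ → ℝ) (Ψ : Fin 2 → ℝ × ℝ → ℝ) : Fin 2 → ℝ × ℝ → ℝ :=
  ![H0 χ (Ψ 0), H2 χ (Ψ 1)]

/-- The entries `H⁽¹⁾_{ij} = q_i^- q_j^+ + p_i^- p_j^+` of the matrix Hamiltonian; on `C²`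
functions, `H⁽¹⁾_{ij} = δ_{ij} H⁽⁰⁾ + 2 ∂_i ∂_j χ`. -/
def H1entry (χ : ℝ × ℝ → ℝ) (i j : Fin 2) (f : ℝ × ℝ → ℝ) (p : ℝ × ℝ) : ℝ :=
  qMinus χ i (qPlus χ j f) p + pMinus χ i (pPlus χ j f) p

/-- The `2 × 2` matrix Hamiltonian `H⁽¹⁾`. -/
def H1 (χ : ℝ × ℝ → ℝ) (Φ : Fin 2 → ℝ × ℝ → ℝ) (i : Fin 2) (p : ℝ × ℝ) : ℝ :=
  ∑ j : Fin 2, H1entry χ i j (Φ j) p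

/-- `P w = (P⁻ w, P⁺ w)ᵀ = (Im w, Re w)ᵀ`. -/
def P (w : ℝ × ℝ → ℂ) : Fin 2 → ℝ × ℝ → ℝ :=
  ![fun p => (w p).im, fun p => (w p).re]

/-! ### The transmutation operators in one variable -/

/-- The potential `q = χ'' + (χ')²`. -/
def potential (χ : ℝ → ℝ) (x : ℝ) : ℝ := deriv (deriv χ) x + (deriv χ x) ^ 2

/-- The number `h = (e^χ)'(0)`. -/
def hConst (χ : ℝ → ℝ) : ℝ := deriv (fun x => Real.exp (χ x)) 0

/-- `K` solves the Goursat problem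
`(∂_x² - q(x)) K(x,t) = ∂_t² K(x,t)`, `K(x,x) = ½ ∫₀ˣ q(s) ds`, `K(x,-x) = 0`
on the square `|x| < a`, `|t| < a`.

As usual for a potential that is merely continuous (when `K` is in general only `C¹`), the
hyperbolic equation is written in the characteristic coordinates `x = u + v`, `t = u - v`, in which
`∂_x² - ∂_t²` is the mixed derivative `∂_u ∂_v`. -/
structure IsGoursatSolution (a : ℝ) (q : ℝ → ℝ) (K : ℝ → ℝ → ℝ) : Prop where
  contDiffOn : ContDiffOn ℝ 1 (fun p : ℝ × ℝ => K p.1 p.2) (Ioo (-a) a ×ˢ Ioo (-a) a)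
  pde : ∀ u v : ℝ, u + v ∈ Ioo (-a) a → u - v ∈ Ioo (-a) a →
    HasDerivAt (fun u' : ℝ => deriv (fun v' : ℝ => K (u' + v') (u' - v')) v)
      (q (u + v) * K (u + v) (u - v)) u
  diag : ∀ x ∈ Ioo (-a) a, K x x = (1 / 2) * ∫ s in (0 : ℝ)..x, q s
  antidiag : ∀ x ∈ Ioo (-a) a, K x (-x) = 0

/-- The solution `K(x,t)` of the Goursat problem for `q = χ'' + (χ')²`; on the square `|x| < a`,
`|t| < a` it is unique. -/
def kernelK (a : ℝ) (χ : ℝ → ℝ) : ℝ → ℝ → ℝ :=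
  Classical.epsilon (fun K : ℝ → ℝ → ℝ => IsGoursatSolution a (potential χ) K)

/-- The kernel
`𝐊(x,t;h) = h/2 + K(x,t) + (h/2) ∫_t^x (K(x,s) - K(x,-s)) ds`. -/
def kernelKh (a : ℝ) (χ : ℝ → ℝ) (x t : ℝ) : ℝ :=
  hConst χ / 2 + kernelK a χ x t
    + hConst χ / 2 * ∫ s in t..x, (kernelK a χ x s - kernelK a χ x (-s))

/-- The transmutation operator `T f(x) = f(x) + ∫_{-x}^x 𝐊(x,t;h) f(t) dt`. -/
def T (a : ℝ) (χ : ℝ → ℝ) (f : ℝ → ℝ) (x : ℝ) : ℝ :=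
  f x + ∫ t in (-x)..x, kernelKh a χ x t * f t

/-- The kernel
`𝐊~(x,t;-h) = -e^{-χ(x)} (∫_{-t}^x ∂_t 𝐊(s,t;h) e^{χ(s)} ds + (h/2) e^{χ(-t)})`. -/
def kernelKtilde (a : ℝ) (χ : ℝ → ℝ) (x t : ℝ) : ℝ :=
  -Real.exp (-χ x) *
    ((∫ s in (-t)..x, deriv (fun τ => kernelKh a χ s τ) t * Real.exp (χ s))
      + hConst χ / 2 * Real.exp (χ (-t)))

/-- The transmutation operator `T~ f(x) = f(x) + ∫_{-x}^x 𝐊~(x,t;-h) f(t) dt`. -/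
def Ttilde (a : ℝ) (χ : ℝ → ℝ) (f : ℝ → ℝ) (x : ℝ) : ℝ :=
  f x + ∫ t in (-x)..x, kernelKtilde a χ x t * f t

/-! ### The transmutation operators in the plane -/

/-- An operator on functions of one variable, applied in the first variable. -/
def inX (S : (ℝ → ℝ) → ℝ → ℝ) (f : ℝ × ℝ → ℝ) (p : ℝ × ℝ) : ℝ :=
  S (fun s => f (s, p.2)) p.1

/-- An operator on functions of one variable, applied in the second variable. -/
def inY (S : (ℝ → ℝ) → ℝ → ℝ) (f : ℝ × ℝ → ℝ) (p : ℝ × ℝ) : ℝ :=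
  S (fun s => f (p.1, s)) p.2

/-- `𝐓₀ = T₁ T₂ P⁺ + i T~₁ T~₂ P⁻`. -/
def bT0 (a₁ a₂ : ℝ) (χ₁ χ₂ : ℝ → ℝ) (w : ℝ × ℝ → ℂ) (p : ℝ × ℝ) : ℂ :=
  (inX (T a₁ χ₁) (inY (T a₂ χ₂) (fun z => (w z).re)) p : ℂ)
    + Complex.I * (inX (Ttilde a₁ χ₁) (inY (Ttilde a₂ χ₂) (fun z => (w z).im)) p : ℂ)

/-- `𝐓₁ = T~₁ T₂ P⁺ + i T₁ T~₂ P⁻`. -/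
def bT1 (a₁ a₂ : ℝ) (χ₁ χ₂ : ℝ → ℝ) (w : ℝ × ℝ → ℂ) (p : ℝ × ℝ) : ℂ :=
  (inX (Ttilde a₁ χ₁) (inY (T a₂ χ₂) (fun z => (w z).re)) p : ℂ)
    + Complex.I * (inX (T a₁ χ₁) (inY (Ttilde a₂ χ₂) (fun z => (w z).im)) p : ℂ)

/-- Together with any point `(x, y)`, the set contains the closed rectangle with vertices
`(x, y)`, `(-x, y)`, `(x, -y)`, `(-x, -y)`. -/
def IsRectSymmetric (Ω : Set (ℝ × ℝ)) : Prop :=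
  ∀ p ∈ Ω, ∀ s t : ℝ, |s| ≤ |p.1| → |t| ≤ |p.2| → (s, t) ∈ Ω

end SUSY

end

/-!
Write `c = χ'`, and `T`, `T~` for the one-variable operators with kernels `𝐊`, `𝐊~`. The kernels
satisfy the Darboux system `(∂_x - c) 𝐊 = -∂_t 𝐊~`, `(∂_x + c) 𝐊~ = -∂_t 𝐊`, which by
differentiation under the integral and integration by parts amounts to `(∂ - c) T = T~ ∂` and
`(∂ + c) T~ = T ∂`. Products of these operators in the two variables hence intertwine the
supercharges with the partial derivatives, and the Hamiltonians with `-Δ`.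

In characteristic coordinates the Goursat problem is a fixed-point equation for an integral operator
which contracts a norm with exponential weight; this gives existence and uniqueness of `K`. Its odd
primitive in `t` solves an equation of the same type, so that `𝐊` is again a Goursat solution, now
with value `h/2` on `t = -x`. By Green's theorem such a solution has a Darboux partner given by an
integral along one characteristic, and integrating the Darboux system along `x` identifies the
partner with `𝐊~`.

The operators only see `w` and `χ` on the rectangle spanned by a point and its reflections, so near
that point both may be replaced by extensions to the whole plane and line.
-/

namespace SUSY

open Filter Topology intervalIntegral

section PartialDerivatives

variable {E : Type*} [NormedAddCommGroup E] [NormedSpace ℝ E] {f g : ℝ × ℝ → E} {p : ℝ × ℝ}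

theorem partialD_zero (f : ℝ × ℝ → E) (p : ℝ × ℝ) :
    partialD 0 f p = deriv (fun s => f (s, p.2)) p.1 :=
  if_pos rfl

theorem partialD_one (f : ℝ × ℝ → E) (p : ℝ × ℝ) :
    partialD 1 f p = deriv (fun s => f (p.1, s)) p.2 :=
  if_neg one_ne_zero

theorem hasDerivAt_partialD_zero (hf : DifferentiableAt ℝ f p) :
    HasDerivAt (fun s => f (s, p.2)) (partialD 0 f p) p.1 := by
  have h : DifferentiableAt ℝ (fun s => f (s, p.2)) p.1 :=
    DifferentiableAt.comp (g := f) p.1 hf (by fun_prop)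
  exact partialD_zero f p ▸ h.hasDerivAt

theorem hasDerivAt_partialD_one (hf : DifferentiableAt ℝ f p) :
    HasDerivAt (fun s => f (p.1, s)) (partialD 1 f p) p.2 := by
  have h : DifferentiableAt ℝ (fun s => f (p.1, s)) p.2 :=
    DifferentiableAt.comp (g := f) p.2 hf (by fun_prop)
  exact partialD_one f p ▸ h.hasDerivAt

theorem partialD_neg (i : Fin 2) (f : ℝ × ℝ → E) : partialD i (-f) = -partialD i f := by
  funext p
  fin_cases i
  · exact (partialD_zero (-f) p).trans <| deriv.fun_neg.trans <|
      congrArg Neg.neg (partialD_zero f p).symm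
  · exact (partialD_one (-f) p).trans <| deriv.fun_neg.trans <|
      congrArg Neg.neg (partialD_one f p).symm

theorem partialD_eq_fderiv (hf : DifferentiableAt ℝ f p) (i : Fin 2) :
    partialD i f p = fderiv ℝ f p (![(1, 0), (0, 1)] i) := by
  fin_cases i
  · exact (hasDerivAt_partialD_zero hf).unique <| HasFDerivAt.comp_hasDerivAt (l := f) p.1
      hf.hasFDerivAt ((hasDerivAt_id p.1).prodMk (hasDerivAt_const p.1 p.2))
  · exact (hasDerivAt_partialD_one hf).unique <| HasFDerivAt.comp_hasDerivAt (l := f) p.2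
      hf.hasFDerivAt ((hasDerivAt_const p.2 p.1).prodMk (hasDerivAt_id p.2))

theorem partialD_eventuallyEq_fderiv (hf : ContDiffAt ℝ 1 f p) (i : Fin 2) :
    partialD i f =ᶠ[𝓝 p] fun q => fderiv ℝ f q (![(1, 0), (0, 1)] i) :=
  (hf.eventually (by simp)).mono fun _ hq => partialD_eq_fderiv (hq.differentiableAt one_ne_zero) i

theorem contDiffAt_partialD {n : ℕ} (hf : ContDiffAt ℝ (n + 1) f p) (i : Fin 2) :
    ContDiffAt ℝ n (partialD i f) p :=
  ((hf.fderiv_right le_rfl).clm_apply contDiffAt_const).congr_of_eventuallyEq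
    (partialD_eventuallyEq_fderiv (hf.of_le (by simp)) i)

theorem contDiff_partialD {n : ℕ} (hf : ContDiff ℝ (n + 1) f) (i : Fin 2) :
    ContDiff ℝ n (partialD i f) :=
  contDiff_iff_contDiffAt.2 fun _ => contDiffAt_partialD hf.contDiffAt i

@[fun_prop]
theorem continuous_partialD (hf : ContDiff ℝ 1 f) (i : Fin 2) : Continuous (partialD i f) :=
  (contDiff_partialD (n := 0) (by simpa using hf) i).continuous

theorem partialD_eventuallyEq (h : f =ᶠ[𝓝 p] g) (i : Fin 2) :
    partialD i f =ᶠ[𝓝 p] partialD i g := by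
  filter_upwards [h.eventually_nhds] with q hq
  have hx : ContinuousAt (fun s : ℝ => (s, q.2)) q.1 := by fun_prop
  have hy : ContinuousAt (fun s : ℝ => (q.1, s)) q.2 := by fun_prop
  fin_cases i
  · exact EventuallyEq.deriv_eq (hx.eventually hq)
  · exact EventuallyEq.deriv_eq (hy.eventually hq)

theorem laplace_eq_of_eventuallyEq (h : f =ᶠ[𝓝 p] g) : laplace f p = laplace g p :=
  Finset.sum_congr rfl fun k _ =>
    (partialD_eventuallyEq (partialD_eventuallyEq h k) k).eq_of_nhds

theorem partialD_comm (hf : ContDiffAt ℝ 2 f p) (i j : Fin 2) :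
    partialD i (partialD j f) p = partialD j (partialD i f) p := by
  have hf' : DifferentiableAt ℝ (fderiv ℝ f) p :=
    (hf.fderiv_right (m := 1) (by norm_num)).differentiableAt one_ne_zero
  have second_derivative (i j : Fin 2) : partialD i (partialD j f) p
      = fderiv ℝ (fderiv ℝ f) p (![(1, 0), (0, 1)] i) (![(1, 0), (0, 1)] j) := by
    have first_derivative := partialD_eventuallyEq_fderiv (hf.of_le (by norm_num)) j
    rw [(partialD_eventuallyEq first_derivative i).eq_of_nhds,
      partialD_eq_fderiv (hf'.clm_apply (differentiableAt_const _)),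
      fderiv_clm_apply hf' (differentiableAt_const _)]
    simp
  rw [second_derivative, second_derivative]
  exact (hf.isSymmSndFDerivAt (by simp)).eq _ _

variable {F : Type*} [NormedAddCommGroup F] [NormedSpace ℝ F]

theorem partialD_clm_comp (L : E →L[ℝ] F) (hf : DifferentiableAt ℝ f p) (i : Fin 2) :
    partialD i (L ∘ f) p = L (partialD i f p) := by
  rw [partialD_eq_fderiv (L.differentiableAt.comp p hf), partialD_eq_fderiv hf,
    fderiv_comp p L.differentiableAt hf, L.fderiv]
  rfl

theorem laplace_clm_comp (L : E →L[ℝ] F) (hf : ContDiffAt ℝ 2 f p) :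
    laplace (L ∘ f) p = L (laplace f p) := by
  have first_order (k : Fin 2) : partialD k (L ∘ f) =ᶠ[𝓝 p] L ∘ partialD k f :=
    (hf.eventually (by simp)).mono fun _ hq =>
      partialD_clm_comp L (hq.differentiableAt two_ne_zero) k
  simp only [laplace, map_sum]
  refine Finset.sum_congr rfl fun k _ => ?_
  rw [(partialD_eventuallyEq (first_order k) k).eq_of_nhds, partialD_clm_comp L]
  exact (contDiffAt_partialD (n := 1) (hf.of_le (by norm_num)) k).differentiableAt one_ne_zero

end PartialDerivatives

section ContinuousPartials

variable {E : Type*} [NormedAddCommGroup E] [NormedSpace ℝ E] {f fx fy : ℝ × ℝ → E}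

/-- `f` has the continuous partial derivatives `fx` and `fy` in the whole plane. -/
structure HasContinuousPartials (f fx fy : ℝ × ℝ → E) : Prop where
  fst : ∀ p, HasDerivAt (fun s => f (s, p.2)) (fx p) p.1
  snd : ∀ p, HasDerivAt (fun s => f (p.1, s)) (fy p) p.2
  continuous_fst : Continuous fx
  continuous_snd : Continuous fy

namespace HasContinuousPartials

theorem hasFDerivAt (h : HasContinuousPartials f fx fy) (p : ℝ × ℝ) :
    HasFDerivAt f ((ContinuousLinearMap.fst ℝ ℝ ℝ).smulRight (fx p)
      + (ContinuousLinearMap.snd ℝ ℝ ℝ).smulRight (fy p)) p := by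
  let toSpan := ContinuousLinearMap.toSpanSingletonCLE (𝕜 := ℝ) (E := E)
  have hx := toSpan.continuous.comp h.continuous_fst
  have hy := toSpan.continuous.comp h.continuous_snd
  refine HasStrictFDerivAt.hasFDerivAt <| (hasStrictFDerivAt_uncurry_coprod (𝕜 := ℝ) (u := p)
    (f := fun s t => f (s, t)) (f₁ := fun s t => toSpan (fx (s, t)))
    (f₂ := fun s t => toSpan (fy (s, t)))
    (Eventually.of_forall fun q => (h.fst q).hasFDerivAt)
    (Eventually.of_forall fun q => (h.snd q).hasFDerivAt)
    hx.continuousAt hy.continuousAt).congr_fderiv ?_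
  ext <;> simp [toSpan, Function.HasUncurry.uncurry]

theorem continuous (h : HasContinuousPartials f fx fy) : Continuous f :=
  continuous_iff_continuousAt.2 fun p => (h.hasFDerivAt p).continuousAt

theorem contDiff_succ {n : ℕ} (h : HasContinuousPartials f fx fy) (hx : ContDiff ℝ n fx)
    (hy : ContDiff ℝ n fy) : ContDiff ℝ (n + 1) f :=
  contDiff_succ_iff_hasFDerivAt.2 ⟨_, (contDiff_const.smulRight hx).add
    (contDiff_const.smulRight hy), h.hasFDerivAt⟩

theorem contDiff_one (h : HasContinuousPartials f fx fy) : ContDiff ℝ 1 f := by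
  simpa using h.contDiff_succ (n := 0) (contDiff_zero.2 h.continuous_fst)
    (contDiff_zero.2 h.continuous_snd)

theorem partialD_zero (h : HasContinuousPartials f fx fy) : partialD 0 f = fx :=
  funext fun p => (SUSY.partialD_zero f p).trans (h.fst p).deriv

theorem partialD_one (h : HasContinuousPartials f fx fy) : partialD 1 f = fy :=
  funext fun p => (SUSY.partialD_one f p).trans (h.snd p).deriv

theorem hasDerivAt_comp (h : HasContinuousPartials f fx fy) {a b : ℝ → ℝ} {a' b' s : ℝ}
    (ha : HasDerivAt a a' s) (hb : HasDerivAt b b' s) :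
    HasDerivAt (fun s => f (a s, b s)) (a' • fx (a s, b s) + b' • fy (a s, b s)) s :=
  HasFDerivAt.comp_hasDerivAt (f := fun s => (a s, b s)) s (h.hasFDerivAt (a s, b s))
    (ha.prodMk hb)

theorem characteristic (h : HasContinuousPartials f fx fy) :
    HasContinuousPartials (fun p => f ((p.1 + p.2) / 2, (p.1 - p.2) / 2))
      (fun p => (1 / 2 : ℝ) • (fx ((p.1 + p.2) / 2, (p.1 - p.2) / 2)
        + fy ((p.1 + p.2) / 2, (p.1 - p.2) / 2)))
      (fun p => (1 / 2 : ℝ) • (fx ((p.1 + p.2) / 2, (p.1 - p.2) / 2)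
        - fy ((p.1 + p.2) / 2, (p.1 - p.2) / 2))) where
  fst p := (h.hasDerivAt_comp (((hasDerivAt_id p.1).add_const p.2).div_const 2)
    (((hasDerivAt_id p.1).sub_const p.2).div_const 2)).congr_deriv (smul_add _ _ _).symm
  snd p := (h.hasDerivAt_comp (((hasDerivAt_id p.2).const_add p.1).div_const 2)
    (((hasDerivAt_id p.2).const_sub p.1).div_const 2)).congr_deriv (by
      simp only [id]; module)
  continuous_fst := by have := h.continuous_fst; have := h.continuous_snd; fun_prop
  continuous_snd := by have := h.continuous_fst; have := h.continuous_snd; fun_prop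

theorem comp_swap (h : HasContinuousPartials f fx fy) :
    HasContinuousPartials (f ∘ Prod.swap) (fy ∘ Prod.swap) (fx ∘ Prod.swap) where
  fst p := h.snd p.swap
  snd p := h.fst p.swap
  continuous_fst := h.continuous_snd.comp continuous_swap
  continuous_snd := h.continuous_fst.comp continuous_swap

end HasContinuousPartials

theorem hasContinuousPartials_partialD (hf : ContDiff ℝ 1 f) :
    HasContinuousPartials f (partialD 0 f) (partialD 1 f) where
  fst _ := hasDerivAt_partialD_zero (hf.differentiable one_ne_zero _)
  snd _ := hasDerivAt_partialD_one (hf.differentiable one_ne_zero _)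
  continuous_fst := continuous_partialD hf 0
  continuous_snd := continuous_partialD hf 1

end ContinuousPartials

section Integrals

variable {E : Type*} [NormedAddCommGroup E] [NormedSpace ℝ E]

theorem hasDerivAt_integral_right [CompleteSpace E] {g : ℝ → E} (hg : Continuous g) (a x : ℝ) :
    HasDerivAt (fun x => ∫ t in a..x, g t) (g x) x :=
  integral_hasDerivAt_right (hg.intervalIntegrable _ _) (hg.stronglyMeasurableAtFilter _ _)
    hg.continuousAt

theorem eq_of_hasDerivAt {f g f' : ℝ → E} (hf : ∀ x, HasDerivAt f (f' x) x)
    (hg : ∀ x, HasDerivAt g (f' x) x) {a : ℝ} (h : f a = g a) : f = g := by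
  refine eq_of_fderiv_eq (𝕜 := ℝ) (fun x => (hf x).differentiableAt)
    (fun x => (hg x).differentiableAt) (fun x => ?_) a h
  rw [(hf x).hasFDerivAt.fderiv, (hg x).hasFDerivAt.fderiv]

@[fun_prop]
theorem continuous_integral_moving {X : Type*} [TopologicalSpace X] [FirstCountableTopology X]
    {g : X → ℝ → E} (hg : Continuous (Function.uncurry g)) {a b : X → ℝ}
    (ha : Continuous a) (hb : Continuous b) : Continuous fun x => ∫ t in a x..b x, g x t := by
  have hgx (x : X) (c d : ℝ) : IntervalIntegrable (g x) volume c d :=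
    (hg.uncurry_left x).intervalIntegrable c d
  have split (x : X) : ∫ t in a x..b x, g x t
      = (∫ t in (0 : ℝ)..b x, g x t) - ∫ t in (0 : ℝ)..a x, g x t :=
    (integral_interval_sub_left (hgx x _ _) (hgx x _ _)).symm
  simp only [split]
  fun_prop

theorem hasDerivAt_integral_param {g g' : ℝ × ℝ → E} (hg : Continuous g) (hg' : Continuous g')
    (hd : ∀ p, HasDerivAt (fun x => g (x, p.2)) (g' p) p.1) (a b x : ℝ) :
    HasDerivAt (fun x => ∫ t in a..b, g (x, t)) (∫ t in a..b, g' (x, t)) x := by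
  obtain ⟨C, hC⟩ := ((isCompact_Icc (a := x - 1) (b := x + 1)).prod
    (isCompact_uIcc (a := a) (b := b))).exists_bound_of_continuousOn hg'.continuousOn
  exact (hasDerivAt_integral_of_dominated_loc_of_deriv_le (F := fun x t => g (x, t))
    (F' := fun x t => g' (x, t)) (bound := fun _ => C) (Icc_mem_nhds (sub_one_lt x) (lt_add_one x))
    (.of_forall fun y => (by fun_prop : Continuous fun t => g (y, t)).aestronglyMeasurable)
    (Continuous.intervalIntegrable (by fun_prop) _ _)
    (by fun_prop : Continuous fun t => g' (x, t)).aestronglyMeasurable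
    (Eventually.of_forall fun t ht y hy => hC (y, t) ⟨hy, uIoc_subset_uIcc ht⟩)
    intervalIntegrable_const (Eventually.of_forall fun t _ y _ => hd (y, t))).2

theorem hasDerivAt_integral_moving [CompleteSpace E] {g g' : ℝ × ℝ → E} (hg : Continuous g)
    (hg' : Continuous g') (hd : ∀ p, HasDerivAt (fun x => g (x, p.2)) (g' p) p.1)
    {a b : ℝ → ℝ} {a' b' x : ℝ} (ha : HasDerivAt a a' x) (hb : HasDerivAt b b' x) :
    HasDerivAt (fun x => ∫ t in a x..b x, g (x, t))
      (b' • g (x, b x) - a' • g (x, a x) + ∫ t in a x..b x, g' (x, t)) x := by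
  have primitive : HasContinuousPartials (fun p => ∫ t in (0 : ℝ)..p.2, g (p.1, t))
      (fun p => ∫ t in (0 : ℝ)..p.2, g' (p.1, t)) g :=
    ⟨fun p => hasDerivAt_integral_param hg hg' hd 0 p.2 p.1,
      fun p => hasDerivAt_integral_right (hg.comp (.prodMk_right p.1)) 0 p.2, by fun_prop, hg⟩
  have split {φ : ℝ × ℝ → E} (hφ : Continuous φ) (x : ℝ) : ∫ t in a x..b x, φ (x, t)
      = (∫ t in (0 : ℝ)..b x, φ (x, t)) - ∫ t in (0 : ℝ)..a x, φ (x, t) :=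
    (integral_interval_sub_left (Continuous.intervalIntegrable (by fun_prop) _ _)
      (Continuous.intervalIntegrable (by fun_prop) _ _)).symm
  rw [funext (split hg), split hg']
  refine ((primitive.hasDerivAt_comp (hasDerivAt_id x) hb).sub
    (primitive.hasDerivAt_comp (hasDerivAt_id x) ha)).congr_deriv ?_
  simp only [id]
  module

end Integrals

section RectIntegral

variable {φ ψ : ℝ × ℝ → ℝ}

/-- The integral of `φ` over the oriented rectangle with opposite vertices `0` and `p`. -/
noncomputable def rectIntegral (φ : ℝ × ℝ → ℝ) (p : ℝ × ℝ) : ℝ :=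
  ∫ β in (0 : ℝ)..p.2, ∫ α in (0 : ℝ)..p.1, φ (α, β)

@[simp]
theorem rectIntegral_fst_zero (φ : ℝ × ℝ → ℝ) (v : ℝ) : rectIntegral φ (0, v) = 0 := by
  simp [rectIntegral]

@[simp]
theorem rectIntegral_snd_zero (φ : ℝ × ℝ → ℝ) (u : ℝ) : rectIntegral φ (u, 0) = 0 :=
  integral_same

theorem hasContinuousPartials_rectIntegral (hφ : Continuous φ) :
    HasContinuousPartials (rectIntegral φ) (fun p => ∫ β in (0 : ℝ)..p.2, φ (p.1, β))
      (fun p => ∫ α in (0 : ℝ)..p.1, φ (α, p.2)) where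
  fst p := hasDerivAt_integral_param (g := fun p => ∫ α in (0 : ℝ)..p.1, φ (α, p.2))
    (by fun_prop) hφ (fun q => hasDerivAt_integral_right (hφ.comp (.prodMk_left q.2)) 0 q.1)
    0 p.2 p.1
  snd p := hasDerivAt_integral_right (g := fun β => ∫ α in (0 : ℝ)..p.1, φ (α, β))
    (by fun_prop) 0 p.2
  continuous_fst := by fun_prop
  continuous_snd := by fun_prop

@[fun_prop]
theorem continuous_rectIntegral (hφ : Continuous φ) : Continuous (rectIntegral φ) :=
  (hasContinuousPartials_rectIntegral hφ).continuous

theorem rectIntegral_comp_swap (hφ : Continuous φ) (p : ℝ × ℝ) :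
    rectIntegral (φ ∘ Prod.swap) p = rectIntegral φ p.swap :=
  intervalIntegral_intervalIntegral_swap (F := fun β α => φ (β, α))
    ((hφ.continuousOn.integrableOn_compact (isCompact_uIcc.prod isCompact_uIcc)).mono_set
      (prod_mono uIoc_subset_uIcc uIoc_subset_uIcc))

theorem rectIntegral_add (hφ : Continuous φ) (hψ : Continuous ψ) (p : ℝ × ℝ) :
    rectIntegral (fun z => φ z + ψ z) p = rectIntegral φ p + rectIntegral ψ p := by
  have inner (β : ℝ) : ∫ α in (0 : ℝ)..p.1, φ (α, β) + ψ (α, β)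
      = (∫ α in (0 : ℝ)..p.1, φ (α, β)) + ∫ α in (0 : ℝ)..p.1, ψ (α, β) :=
    integral_add (Continuous.intervalIntegrable (by fun_prop) _ _)
      (Continuous.intervalIntegrable (by fun_prop) _ _)
  simp only [rectIntegral, inner]
  exact integral_add (Continuous.intervalIntegrable (by fun_prop) _ _)
    (Continuous.intervalIntegrable (by fun_prop) _ _)

theorem rectIntegral_const_mul (c : ℝ) (φ : ℝ × ℝ → ℝ) (p : ℝ × ℝ) :
    rectIntegral (fun z => c * φ z) p = c * rectIntegral φ p := by
  simp only [rectIntegral, intervalIntegral.integral_const_mul]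

theorem rectIntegral_sub (hφ : Continuous φ) (hψ : Continuous ψ) (p : ℝ × ℝ) :
    rectIntegral (fun z => φ z - ψ z) p = rectIntegral φ p - rectIntegral ψ p := by
  have h := rectIntegral_add (by fun_prop : Continuous fun z => φ z - ψ z) hψ p
  simp only [sub_add_cancel] at h
  exact eq_sub_of_add_eq h.symm

theorem abs_le_abs_of_mem_uIcc_zero {a x : ℝ} (h : x ∈ uIcc 0 a) : |x| ≤ |a| := by
  simpa using abs_sub_left_of_mem_uIcc h

theorem rectIntegral_congr {p : ℝ × ℝ}
    (h : ∀ α β, |α| ≤ |p.1| → |β| ≤ |p.2| → φ (α, β) = ψ (α, β)) :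
    rectIntegral φ p = rectIntegral ψ p :=
  integral_congr fun β hβ => integral_congr fun α hα =>
    h α β (abs_le_abs_of_mem_uIcc_zero hα) (abs_le_abs_of_mem_uIcc_zero hβ)

theorem abs_integral_le_exp {l : ℝ} (hl : 0 < l) {f : ℝ → ℝ} {C u : ℝ}
    (h : ∀ α, |α| ≤ |u| → |f α| ≤ C * Real.exp (l * |α|)) :
    |∫ α in (0 : ℝ)..u, f α| ≤ C / l * Real.exp (l * |u|) := by
  wlog hu : 0 ≤ u generalizing f u
  · have := this (f := fun α => f (-α)) (u := -u) (fun α hα => by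
      simpa using h (-α) (by simpa using hα)) (by linarith)
    rwa [intervalIntegral.integral_comp_neg, neg_neg, neg_zero, integral_symm, abs_neg,
      abs_neg u] at this
  have hC : 0 ≤ C := by simpa using (abs_nonneg _).trans (h 0 (by simp))
  have primitive (α : ℝ) :
      HasDerivAt (fun α => C / l * Real.exp (l * α)) (C * Real.exp (l * α)) α :=
    (((hasDerivAt_id α).const_mul l).exp.const_mul (C / l)).congr_deriv (by
      simp only [id]; field_simp)
  have value : ∫ α in (0 : ℝ)..u, C * Real.exp (l * α)
      = C / l * Real.exp (l * u) - C / l * Real.exp (l * 0) :=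
    integral_eq_sub_of_hasDerivAt (fun α _ => primitive α)
      (Continuous.intervalIntegrable (by fun_prop) _ _)
  calc |∫ α in (0 : ℝ)..u, f α| ≤ ∫ α in (0 : ℝ)..u, C * Real.exp (l * α) := by
        rw [← Real.norm_eq_abs]
        refine norm_integral_le_of_norm_le hu (Eventually.of_forall fun α hα => ?_)
          (Continuous.intervalIntegrable (u := fun α => C * Real.exp (l * α)) (by fun_prop) _ _)
        have := h α (abs_le_abs_of_mem_uIcc_zero (uIcc_of_le hu ▸ Ioc_subset_Icc_self hα))
        rwa [abs_of_pos hα.1] at this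
    _ ≤ C / l * Real.exp (l * |u|) := by
        rw [value, abs_of_nonneg hu]
        exact sub_le_self _ (by positivity)

theorem abs_rectIntegral_le_exp {l : ℝ} (hl : 0 < l) {C : ℝ} {p : ℝ × ℝ}
    (h : ∀ α β, |α| ≤ |p.1| → |β| ≤ |p.2| → |φ (α, β)| ≤ C * Real.exp (l * (|α| + |β|))) :
    |rectIntegral φ p| ≤ C / l ^ 2 * Real.exp (l * (|p.1| + |p.2|)) := by
  have inner (β : ℝ) (hβ : |β| ≤ |p.2|) : |∫ α in (0 : ℝ)..p.1, φ (α, β)|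
      ≤ C / l * Real.exp (l * |p.1|) * Real.exp (l * |β|) := by
    convert abs_integral_le_exp hl (C := C * Real.exp (l * |β|)) fun α hα =>
      (h α β hα hβ).trans_eq ?_ using 1
    · ring
    · rw [mul_add, Real.exp_add]
      ring
  refine (abs_integral_le_exp hl inner).trans_eq ?_
  rw [mul_add, Real.exp_add]
  field_simp

end RectIntegral

section WeightedContraction

theorem exists_continuous_fixedPoint_of_weighted_contraction {X E : Type*} [TopologicalSpace X]
    [NormedAddCommGroup E] [NormedSpace ℝ E] [CompleteSpace E] {ω : X → ℝ} (hω : Continuous ω)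
    (hω₀ : ∀ x, 0 < ω x) {Φ : (X → E) → X → E} (hΦ : ∀ W, Continuous W → Continuous (Φ W))
    {C : ℝ} (hC : ∀ x, ‖Φ 0 x‖ ≤ C * ω x) {K : NNReal} (hK : K < 1)
    (hΦK : ∀ W₁ W₂, Continuous W₁ → Continuous W₂ → ∀ m, (∀ x, ‖W₁ x - W₂ x‖ ≤ m * ω x) →
      ∀ x, ‖Φ W₁ x - Φ W₂ x‖ ≤ K * m * ω x) :
    ∃ W, Continuous W ∧ Φ W = W := by
  let scale (w : BoundedContinuousFunction X E) (x : X) : E := ω x • w x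
  have scale_continuous (w) : Continuous (scale w) := hω.smul w.continuous
  have scale_sub_le (w w') (x : X) : ‖scale w x - scale w' x‖ ≤ dist w w' * ω x := by
    rw [← smul_sub, norm_smul, Real.norm_of_nonneg (hω₀ x).le, mul_comm, ← dist_eq_norm]
    exact mul_le_mul_of_nonneg_right (BoundedContinuousFunction.dist_coe_le_dist x) (hω₀ x).le
  have unscale_le {y : E} {x : X} {b : ℝ} (h : ‖y‖ ≤ b * ω x) : ‖(ω x)⁻¹ • y‖ ≤ b := by
    rwa [norm_smul, norm_inv, Real.norm_of_nonneg (hω₀ x).le, inv_mul_le_iff₀' (hω₀ x)]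
  let F (w : BoundedContinuousFunction X E) : BoundedContinuousFunction X E :=
    .ofNormedAddCommGroup (fun x => (ω x)⁻¹ • Φ (scale w) x)
      ((hω.inv₀ fun x => (hω₀ x).ne').smul (hΦ _ (scale_continuous w)))
      (K * dist w 0 + C) fun x => unscale_le <| by
        have h := hΦK _ 0 (scale_continuous w) continuous_zero _
          (by simpa [scale] using scale_sub_le w 0) x
        rw [add_mul]
        exact (norm_le_norm_sub_add _ _).trans (add_le_add h (hC x))
  have hF : ContractingWith K F := by
    refine ⟨hK, LipschitzWith.of_dist_le_mul fun w w' => ?_⟩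
    refine (BoundedContinuousFunction.dist_le (by positivity)).2 fun x => ?_
    rw [dist_eq_norm]
    change ‖(ω x)⁻¹ • Φ (scale w) x - (ω x)⁻¹ • Φ (scale w') x‖ ≤ _
    rw [← smul_sub]
    exact unscale_le <| hΦK _ _ (scale_continuous w) (scale_continuous w') _ (scale_sub_le w w') x
  obtain ⟨w, hw⟩ : ∃ w, F w = w := ⟨hF.fixedPoint, hF.fixedPoint_isFixedPt⟩
  refine ⟨scale w, scale_continuous w, funext fun x => ?_⟩
  rw [← inv_smul_eq_iff₀ (hω₀ x).ne']
  exact DFunLike.congr_fun hw x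

theorem eqOn_of_weighted_contraction {X E : Type*} [TopologicalSpace X] [NormedAddCommGroup E]
    {ω : X → ℝ} (hω : Continuous ω) (hω₀ : ∀ x, 0 < ω x) {s : Set X} (hs : IsCompact s)
    {W₁ W₂ : X → E} (hW₁ : ContinuousOn W₁ s) (hW₂ : ContinuousOn W₂ s) {K : ℝ} (hK : K < 1)
    (h : ∀ m, (∀ x ∈ s, ‖W₁ x - W₂ x‖ ≤ m * ω x) → ∀ x ∈ s, ‖W₁ x - W₂ x‖ ≤ K * m * ω x) :
    EqOn W₁ W₂ s := by
  intro x₀ hx₀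
  obtain ⟨x, hx, hmax⟩ := hs.exists_isMaxOn ⟨x₀, hx₀⟩ (f := fun x => ‖W₁ x - W₂ x‖ / ω x)
    ((hW₁.sub hW₂).norm.div hω.continuousOn fun x _ => (hω₀ x).ne')
  set m := ‖W₁ x - W₂ x‖ / ω x
  have bound (y) (hy : y ∈ s) : ‖W₁ y - W₂ y‖ ≤ m * ω y := (div_le_iff₀ (hω₀ y)).1 (hmax hy)
  have hm : m ≤ K * m := (div_le_iff₀ (hω₀ x)).2 (h m bound x hx)
  have hm₀ : m ≤ 0 := by nlinarith
  exact sub_eq_zero.1 <| norm_le_zero_iff.1 <| (bound x₀ hx₀).trans <|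
    mul_nonpos_of_nonpos_of_nonneg hm₀ (hω₀ x₀).le

end WeightedContraction

section GoursatIntegral

variable {q : ℝ → ℝ} {c B m r : ℝ} {W W₁ W₂ : ℝ × ℝ → ℝ}

/-- The right-hand side of the integral form of the Goursat problem
`∂_u ∂_v W = q(u + v) W`, `W(u, 0) = c + ½ ∫₀ᵘ q`, `W(0, v) = c` in characteristic coordinates. -/
noncomputable def goursatOperator (q : ℝ → ℝ) (c : ℝ) (W : ℝ × ℝ → ℝ) (p : ℝ × ℝ) : ℝ :=
  c + 1 / 2 * (∫ s in (0 : ℝ)..p.1, q s) + rectIntegral (fun z => q (z.1 + z.2) * W z) p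

@[fun_prop]
theorem continuous_goursatOperator (hq : Continuous q) (hW : Continuous W) :
    Continuous (goursatOperator q c W) := by
  unfold goursatOperator
  fun_prop

theorem abs_goursatOperator_sub_le (hq : Continuous q) (hW₁ : Continuous W₁)
    (hW₂ : Continuous W₂) {p : ℝ × ℝ} (hB : ∀ s, |s| ≤ |p.1| + |p.2| → |q s| ≤ B)
    (h : ∀ α β, |α| ≤ |p.1| → |β| ≤ |p.2| →
      |W₁ (α, β) - W₂ (α, β)| ≤ m * Real.exp ((2 * B + 1) * (|α| + |β|))) :
    |goursatOperator q c W₁ p - goursatOperator q c W₂ p|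
      ≤ m / 2 * Real.exp ((2 * B + 1) * (|p.1| + |p.2|)) := by
  have hB₀ : 0 ≤ B := (abs_nonneg _).trans (hB 0 (by simp only [abs_zero]; positivity))
  have hm : 0 ≤ m := by simpa using (abs_nonneg _).trans (h 0 0 (by simp) (by simp))
  rw [goursatOperator, goursatOperator, add_sub_add_left_eq_sub,
    ← rectIntegral_sub (by fun_prop) (by fun_prop)]
  refine (abs_rectIntegral_le_exp (l := 2 * B + 1) (C := B * m) (by positivity)
    fun α β hα hβ => ?_).trans (mul_le_mul_of_nonneg_right ?_ (Real.exp_pos _).le)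
  · rw [← mul_sub, abs_mul, mul_assoc]
    exact mul_le_mul (hB _ ((abs_add_le _ _).trans (add_le_add hα hβ))) (h α β hα hβ)
      (abs_nonneg _) hB₀
  · rw [div_le_iff₀ (by positivity)]
    nlinarith [mul_nonneg hm hB₀, mul_nonneg hm (sq_nonneg B)]

/-- The closed square with vertices `(±r, 0)` and `(0, ±r)`. In characteristic coordinates it is
the square `|x|, |t| ≤ r`. -/
def diamond (r : ℝ) : Set (ℝ × ℝ) :=
  {p | |p.1| + |p.2| ≤ r}

theorem isCompact_diamond (r : ℝ) : IsCompact (diamond r) :=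
  (isCompact_Icc (a := (-r, -r)) (b := (r, r))).of_isClosed_subset
    (isClosed_le (by fun_prop) continuous_const) fun p (hp : |p.1| + |p.2| ≤ r) =>
      ⟨⟨(abs_le.1 (by linarith [abs_nonneg p.2])).1, (abs_le.1 (by linarith [abs_nonneg p.1])).1⟩,
        (abs_le.1 (by linarith [abs_nonneg p.2])).2, (abs_le.1 (by linarith [abs_nonneg p.1])).2⟩

theorem abs_add_le_of_mem_diamond {p : ℝ × ℝ} (hp : p ∈ diamond r) : |p.1 + p.2| ≤ r :=
  (abs_add_le _ _).trans hp

theorem mem_diamond_of_abs_le {p : ℝ × ℝ} (hp : p ∈ diamond r) {α β : ℝ} (hα : |α| ≤ |p.1|)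
    (hβ : |β| ≤ |p.2|) : (α, β) ∈ diamond r :=
  (add_le_add hα hβ).trans hp

theorem goursatOperator_congr {q' : ℝ → ℝ} {p : ℝ × ℝ} (hp : p ∈ diamond r)
    (hq : ∀ s, |s| ≤ r → q s = q' s) (hW : EqOn W₁ W₂ (diamond r)) :
    goursatOperator q c W₁ p = goursatOperator q' c W₂ p := by
  have datum : ∫ s in (0 : ℝ)..p.1, q s = ∫ s in (0 : ℝ)..p.1, q' s :=
    integral_congr fun s hs => hq s <| (abs_le_abs_of_mem_uIcc_zero hs).trans <|
      (le_add_of_nonneg_right (abs_nonneg _)).trans hp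
  rw [goursatOperator, goursatOperator, datum, rectIntegral_congr fun α β hα hβ => ?_]
  have hαβ := mem_diamond_of_abs_le hp hα hβ
  simp only [hq _ (abs_add_le_of_mem_diamond hαβ), hW hαβ]

theorem exists_continuous_eqOn_diamond (hW : ContinuousOn W (diamond r)) :
    ∃ W' : ℝ × ℝ → ℝ, Continuous W' ∧ EqOn W' W (diamond r) := by
  obtain ⟨W', hW'⟩ := ContinuousMap.exists_restrict_eq (isCompact_diamond r).isClosed
    ⟨(diamond r).domRestrict W, hW.domRestrict⟩
  exact ⟨W', W'.continuous, fun p hp => DFunLike.congr_fun hW' ⟨p, hp⟩⟩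

theorem exists_bounded_continuous_extension (hr : 0 ≤ r) (hq : ContinuousOn q (Icc (-r) r)) :
    ∃ q' : ℝ → ℝ, Continuous q' ∧ (∀ s, |s| ≤ r → q' s = q s) ∧ ∃ B, ∀ s, |q' s| ≤ B := by
  have hrr : -r ≤ r := neg_le_self hr
  obtain ⟨B, hB⟩ := isCompact_Icc.exists_bound_of_continuousOn hq
  exact ⟨IccExtend hrr ((Icc (-r) r).domRestrict q), hq.domRestrict.Icc_extend',
    fun s hs => IccExtend_of_mem hrr _ (abs_le.1 hs), B, fun s => hB _ (projIcc _ _ hrr s).2⟩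

theorem eqOn_diamond_of_eq_goursatOperator (hq : ContinuousOn q (Icc (-r) r))
    (hW₁ : ContinuousOn W₁ (diamond r)) (hW₂ : ContinuousOn W₂ (diamond r))
    (h₁ : ∀ p ∈ diamond r, W₁ p = goursatOperator q c W₁ p)
    (h₂ : ∀ p ∈ diamond r, W₂ p = goursatOperator q c W₂ p) : EqOn W₁ W₂ (diamond r) := by
  rcases lt_or_ge r 0 with hr | hr
  · exact fun p hp => absurd ((abs_nonneg _).trans (abs_add_le_of_mem_diamond hp)) hr.not_ge
  obtain ⟨q', hq', hqq', B, hB⟩ := exists_bounded_continuous_extension hr hq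
  obtain ⟨V₁, hV₁, hVW₁⟩ := exists_continuous_eqOn_diamond hW₁
  obtain ⟨V₂, hV₂, hVW₂⟩ := exists_continuous_eqOn_diamond hW₂
  refine eqOn_of_weighted_contraction
    (ω := fun p : ℝ × ℝ => Real.exp ((2 * B + 1) * (|p.1| + |p.2|))) (by fun_prop)
    (fun _ => Real.exp_pos _) (isCompact_diamond r) hW₁ hW₂ one_half_lt_one fun m h p hp => ?_
  rw [h₁ p hp, h₂ p hp, goursatOperator_congr hp (fun s hs => (hqq' s hs).symm) hVW₁.symm,
    goursatOperator_congr hp (fun s hs => (hqq' s hs).symm) hVW₂.symm, one_div_mul_eq_div]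
  refine abs_goursatOperator_sub_le hq' hV₁ hV₂ (fun s _ => hB s) fun α β hα hβ => ?_
  have hαβ := mem_diamond_of_abs_le hp hα hβ
  rw [hVW₁ hαβ, hVW₂ hαβ]
  exact h _ hαβ

/-- `W` is a continuous solution of the integral form of the Goursat problem with potential `q`
in the whole plane; the constant `c` is its value on the characteristic `u = 0`. -/
structure IsGoursatIntegral (q : ℝ → ℝ) (c : ℝ) (W : ℝ × ℝ → ℝ) : Prop where
  continuous : Continuous W
  eq_goursatOperator : ∀ p, W p = goursatOperator q c W p

theorem abs_goursatOperator_zero_le (hB : ∀ s, |q s| ≤ B) (p : ℝ × ℝ) :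
    |goursatOperator q c 0 p| ≤ (|c| + B) * Real.exp ((2 * B + 1) * (|p.1| + |p.2|)) := by
  have hB₀ : 0 ≤ B := (abs_nonneg _).trans (hB 0)
  have datum : |∫ s in (0 : ℝ)..p.1, q s| ≤ B * |p.1| := by
    simpa using norm_integral_le_of_norm_le_const (a := 0) (b := p.1) (f := q) fun s _ => hB s
  calc |goursatOperator q c 0 p| ≤ |c| + |1 / 2 * ∫ s in (0 : ℝ)..p.1, q s| := by
        have no_rectangle : rectIntegral (fun z => q (z.1 + z.2) * (0 : ℝ × ℝ → ℝ) z) p = 0 := by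
          simp [rectIntegral]
        rw [goursatOperator, no_rectangle, add_zero]
        exact abs_add_le _ _
    _ ≤ (|c| + B) * (1 + (2 * B + 1) * (|p.1| + |p.2|)) := by
        rw [abs_mul, abs_of_pos (one_half_pos (α := ℝ))]
        nlinarith [abs_nonneg c, abs_nonneg p.1, abs_nonneg p.2,
          mul_nonneg (abs_nonneg c) (abs_nonneg p.1), mul_nonneg (abs_nonneg c) (abs_nonneg p.2),
          mul_nonneg hB₀ (abs_nonneg p.1), mul_nonneg hB₀ (abs_nonneg p.2)]
    _ ≤ (|c| + B) * Real.exp ((2 * B + 1) * (|p.1| + |p.2|)) := by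
        rw [add_comm 1]
        gcongr
        exact Real.add_one_le_exp _

theorem exists_isGoursatIntegral (hq : Continuous q) (hB : ∀ s, |q s| ≤ B) (c : ℝ) :
    ∃ W, IsGoursatIntegral q c W := by
  obtain ⟨W, hW, hW_eq⟩ := exists_continuous_fixedPoint_of_weighted_contraction
    (ω := fun p : ℝ × ℝ => Real.exp ((2 * B + 1) * (|p.1| + |p.2|))) (by fun_prop)
    (fun _ => Real.exp_pos _) (Φ := goursatOperator q c)
    (fun _ hW => continuous_goursatOperator hq hW) (abs_goursatOperator_zero_le hB)
    (K := 1 / 2) (NNReal.half_lt_self one_ne_zero) fun W₁ W₂ hW₁ hW₂ m h p =>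
      (abs_goursatOperator_sub_le hq hW₁ hW₂ (fun s _ => hB s) fun α β _ _ => h (α, β)).trans_eq
        (by push_cast; ring)
  exact ⟨W, hW, fun p => (congrFun hW_eq p).symm⟩

end GoursatIntegral

section OddPrimitive

variable {q : ℝ → ℝ} {c : ℝ} {K W w w' : ℝ × ℝ → ℝ}

theorem hasDerivAt_integral_characteristic (hq : Continuous q) (hw : Continuous w)
    (hw' : Continuous w') (hd : ∀ p, HasDerivAt (fun t => w (p.1, t)) (w' p) p.2) (u v : ℝ) :
    HasDerivAt (fun v => ∫ α in (0 : ℝ)..u, q (α + v) * w (α + v, α - v))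
      (q (u + v) * w (u + v, u - v) - q v * w (v, -v)
        - 2 * ∫ α in (0 : ℝ)..u, q (α + v) * w' (α + v, α - v)) v := by
  have shift (w : ℝ × ℝ → ℝ) (v : ℝ) : ∫ α in (0 : ℝ)..u, q (α + v) * w (α + v, α - v)
      = ∫ s in v..(u + v), q s * w (s, s - 2 * v) := by
    have h := intervalIntegral.integral_comp_add_right (a := 0) (b := u)
      (fun s => q s * w (s, s - 2 * v)) v
    rw [zero_add] at h
    rw [← h]
    exact integral_congr fun α _ => by ring_nf
  have integrand (p : ℝ × ℝ) : HasDerivAt (fun v => q p.2 * w (p.2, p.2 - 2 * v))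
      (q p.2 * (w' (p.2, p.2 - 2 * p.1) * (-2))) p.1 :=
    ((hd (p.2, p.2 - 2 * p.1)).comp p.1 <| (((hasDerivAt_id p.1).const_mul 2).const_sub
      p.2).congr_deriv (by ring)).const_mul _
  rw [funext (shift w), shift w' v, ← intervalIntegral.integral_const_mul]
  refine (hasDerivAt_integral_moving (g := fun p => q p.2 * w (p.2, p.2 - 2 * p.1))
    (by fun_prop) (by fun_prop) integrand (hasDerivAt_id v)
    ((hasDerivAt_id v).const_add u)).congr_deriv ?_
  rw [sub_eq_add_neg _ (∫ _ in _.._, _), ← intervalIntegral.integral_neg]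
  refine congrArg₂ (· + ·) ?_ (integral_congr fun s _ => ?_)
  · simp only [id, smul_eq_mul]
    ring_nf
  · ring

-- Divergence theorem on a characteristic rectangle: `q(x)` commutes with `∂_t`, so it need not be
-- differentiated.
theorem two_mul_rectIntegral_characteristic (hq : Continuous q) (hw : Continuous w)
    (hw' : Continuous w') (hd : ∀ p, HasDerivAt (fun t => w (p.1, t)) (w' p) p.2) (p : ℝ × ℝ) :
    2 * rectIntegral (fun z => q (z.1 + z.2) * w' (z.1 + z.2, z.1 - z.2)) p
      = (∫ α in (0 : ℝ)..p.1, q α * w (α, α))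
        + (∫ β in (0 : ℝ)..p.2, (q (p.1 + β) * w (p.1 + β, p.1 - β) - q β * w (β, -β)))
        - ∫ α in (0 : ℝ)..p.1, q (α + p.2) * w (α + p.2, α - p.2) := by
  obtain ⟨u, v⟩ := p
  have flux_derivative (v : ℝ) : HasDerivAt (fun v => (∫ α in (0 : ℝ)..u, q α * w (α, α))
        + (∫ β in (0 : ℝ)..v, (q (u + β) * w (u + β, u - β) - q β * w (β, -β)))
        - ∫ α in (0 : ℝ)..u, q (α + v) * w (α + v, α - v))
      (2 * ∫ α in (0 : ℝ)..u, q (α + v) * w' (α + v, α - v)) v :=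
    (((hasDerivAt_integral_right (by fun_prop) 0 v).const_add _).sub
      (hasDerivAt_integral_characteristic hq hw hw' hd u v)).congr_deriv (sub_sub_cancel _ _)
  have rectangle_derivative (v : ℝ) : HasDerivAt (fun v => 2 * rectIntegral
        (fun z => q (z.1 + z.2) * w' (z.1 + z.2, z.1 - z.2)) (u, v))
      (2 * ∫ α in (0 : ℝ)..u, q (α + v) * w' (α + v, α - v)) v :=
    ((hasContinuousPartials_rectIntegral (by fun_prop)).snd (u, v)).const_mul 2
  exact congrFun (eq_of_hasDerivAt rectangle_derivative flux_derivative (a := 0) (by simp)) v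

/-- The integral `∫_t^x (K(x,s) - K(x,-s)) ds` that enters the kernel `𝐊(x,t;h)`. -/
noncomputable def oddPrimitive (K : ℝ × ℝ → ℝ) (p : ℝ × ℝ) : ℝ :=
  ∫ s in p.2..p.1, (K (p.1, s) - K (p.1, -s))

@[fun_prop]
theorem continuous_oddPrimitive (hK : Continuous K) : Continuous (oddPrimitive K) := by
  unfold oddPrimitive
  fun_prop

theorem hasDerivAt_oddPrimitive (hK : Continuous K) (p : ℝ × ℝ) :
    HasDerivAt (fun t => oddPrimitive K (p.1, t)) (K (p.1, -p.2) - K p) p.2 := by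
  have h : Continuous fun s => K (p.1, s) - K (p.1, -s) := by fun_prop
  exact (integral_hasDerivAt_left (h.intervalIntegrable _ _) (h.stronglyMeasurableAtFilter _ _)
    h.continuousAt).congr_deriv (neg_sub _ _)

@[simp]
theorem oddPrimitive_diag (x : ℝ) : oddPrimitive K (x, x) = 0 :=
  integral_same

@[simp]
theorem oddPrimitive_antidiag (x : ℝ) : oddPrimitive K (x, -x) = 0 := by
  have h := intervalIntegral.integral_comp_neg (a := -x) (b := x)
    (fun s => K (x, s) - K (x, -s))
  have negated : ∫ s in (-x)..x, (K (x, -s) - K (x, s)) = -oddPrimitive K (x, -x) := by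
    simp only [oddPrimitive, ← intervalIntegral.integral_neg, neg_sub]
  simp only [neg_neg] at h
  exact self_eq_neg.1 (h.symm.trans negated)

theorem IsGoursatIntegral.sub_swap_eq (hq : Continuous q) (hW : IsGoursatIntegral q c W)
    (p : ℝ × ℝ) :
    W p - W p.swap = 1 / 2 * (∫ s in (0 : ℝ)..p.1, q s) - 1 / 2 * (∫ s in (0 : ℝ)..p.2, q s)
      + rectIntegral (fun z => q (z.1 + z.2) * (W z - W z.swap)) p := by
  have hWc := hW.continuous
  have swapped : rectIntegral (fun z => q (z.1 + z.2) * W z) p.swap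
      = rectIntegral (fun z => q (z.1 + z.2) * W z.swap) p := by
    rw [← rectIntegral_comp_swap (by fun_prop)]
    exact congrFun (congrArg rectIntegral (funext fun z => by simp [add_comm])) p
  simp only [mul_sub]
  rw [rectIntegral_sub (by fun_prop) (by fun_prop), ← swapped, hW.eq_goursatOperator p,
    hW.eq_goursatOperator p.swap]
  simp only [goursatOperator, Prod.fst_swap]
  ring

theorem integral_sub_integral_one_add_oddPrimitive (hq : Continuous q) (hK : Continuous K)
    (hW : IsGoursatIntegral q c fun z => K (z.1 + z.2, z.1 - z.2)) (p : ℝ × ℝ) :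
    (∫ β in (0 : ℝ)..p.2, q (p.1 + β) * (1 + oddPrimitive K (p.1 + β, p.1 - β)))
        - ∫ α in (0 : ℝ)..p.1, q (α + p.2) * (1 + oddPrimitive K (α + p.2, α - p.2))
      = 2 * (K (p.1 + p.2, -(p.1 - p.2)) - K (p.1 + p.2, p.1 - p.2)) := by
  have flux := two_mul_rectIntegral_characteristic hq (w := fun p => 1 + oddPrimitive K p)
    (by fun_prop) (w' := fun p => K (p.1, -p.2) - K p) (by fun_prop)
    (fun p => (hasDerivAt_oddPrimitive hK p).const_add 1) p
  have boundary : ∫ β in (0 : ℝ)..p.2,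
        (q (p.1 + β) * (1 + oddPrimitive K (p.1 + β, p.1 - β)) - q β)
      = (∫ β in (0 : ℝ)..p.2, q (p.1 + β) * (1 + oddPrimitive K (p.1 + β, p.1 - β)))
        - ∫ β in (0 : ℝ)..p.2, q β :=
    integral_sub (Continuous.intervalIntegrable (by fun_prop) _ _) (hq.intervalIntegrable _ _)
  have swapped (z : ℝ × ℝ) :
      K (z.swap.1 + z.swap.2, z.swap.1 - z.swap.2) = K (z.1 + z.2, -(z.1 - z.2)) := by
    rw [Prod.fst_swap, Prod.snd_swap, neg_sub, add_comm]
  have odd := hW.sub_swap_eq hq p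
  have negated (z : ℝ × ℝ) :
      q (z.1 + z.2) * (K (z.1 + z.2, z.1 - z.2) - K (z.1 + z.2, -(z.1 - z.2)))
        = -1 * (q (z.1 + z.2) * (K (z.1 + z.2, -(z.1 - z.2)) - K (z.1 + z.2, z.1 - z.2))) := by
    ring
  simp only [oddPrimitive_diag, oddPrimitive_antidiag, add_zero, mul_one, boundary] at flux
  simp only [swapped, negated, rectIntegral_const_mul] at odd
  linarith

theorem oddPrimitive_eq_rectIntegral (hq : Continuous q) (hK : Continuous K)
    (hW : IsGoursatIntegral q c fun z => K (z.1 + z.2, z.1 - z.2)) (p : ℝ × ℝ) :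
    oddPrimitive K p = rectIntegral (fun z => q (z.1 + z.2)
      * (1 + oddPrimitive K (z.1 + z.2, z.1 - z.2))) ((p.1 + p.2) / 2, (p.1 - p.2) / 2) := by
  have partials := (hasContinuousPartials_rectIntegral (φ := fun z => q (z.1 + z.2)
      * (1 + oddPrimitive K (z.1 + z.2, z.1 - z.2))) (by fun_prop)).characteristic
  refine congrFun (eq_of_hasDerivAt (f := fun t => oddPrimitive K (p.1, t))
    (g := fun t => rectIntegral _ ((p.1 + t) / 2, (p.1 - t) / 2))
    (fun t => hasDerivAt_oddPrimitive hK (p.1, t))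
    (fun t => (partials.snd (p.1, t)).congr_deriv ?_) (a := p.1) (by simp)) p.2
  have slopes := integral_sub_integral_one_add_oddPrimitive hq hK hW ((p.1 + t) / 2, (p.1 - t) / 2)
  have sum : (p.1 + t) / 2 + (p.1 - t) / 2 = p.1 := by ring
  have diff : (p.1 + t) / 2 - (p.1 - t) / 2 = t := by ring
  simp only [sum, diff] at slopes
  simp only [smul_eq_mul]
  linarith

theorem IsGoursatIntegral.add_oddPrimitive (hq : Continuous q) (hK : Continuous K)
    (hW : IsGoursatIntegral q 0 fun z => K (z.1 + z.2, z.1 - z.2)) (c : ℝ) :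
    IsGoursatIntegral q c fun z => c + K (z.1 + z.2, z.1 - z.2)
      + c * oddPrimitive K (z.1 + z.2, z.1 - z.2) where
  continuous := by fun_prop
  eq_goursatOperator p := by
    have odd := oddPrimitive_eq_rectIntegral hq hK hW (p.1 + p.2, p.1 - p.2)
    have expand : rectIntegral (fun z => q (z.1 + z.2) * (c + K (z.1 + z.2, z.1 - z.2)
          + c * oddPrimitive K (z.1 + z.2, z.1 - z.2))) p
        = rectIntegral (fun z => q (z.1 + z.2) * K (z.1 + z.2, z.1 - z.2)) p
          + c * rectIntegral (fun z => q (z.1 + z.2)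
            * (1 + oddPrimitive K (z.1 + z.2, z.1 - z.2))) p := by
      rw [← rectIntegral_const_mul, ← rectIntegral_add (by fun_prop) (by fun_prop)]
      exact congrFun (congrArg rectIntegral (funext fun z => by ring)) p
    rw [hW.eq_goursatOperator p, odd]
    simp only [goursatOperator, expand, add_add_sub_cancel, add_sub_sub_cancel, add_self_div_two]
    ring

end OddPrimitive

section Volterra

/-- The Volterra operator `f ↦ f + ∫_{-x}^x k(x,t) f(t) dt`; both `T` and `Ttilde` are of this
form. -/
noncomputable def volterra (k : ℝ × ℝ → ℝ) (f : ℝ → ℝ) (x : ℝ) : ℝ :=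
  f x + ∫ t in (-x)..x, k (x, t) * f t

/-- The product of the Volterra operator with kernel `k` in the first variable and the one with
kernel `m` in the second variable. -/
noncomputable def planeVolterra (k m : ℝ × ℝ → ℝ) (f : ℝ × ℝ → ℝ) : ℝ × ℝ → ℝ :=
  inX (volterra k) (inY (volterra m) f)

/-- Kernels `k`, `l` of Volterra operators related by the first-order Darboux system
`(∂_x - c(x)) k = -∂_t l`, `(∂_x + c(x)) l = -∂_t k`, together with the values on the diagonals
that make `∂ - c` intertwine the two operators. -/
structure IsDarbouxPair (c : ℝ → ℝ) (k l : ℝ × ℝ → ℝ) : Prop where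
  contDiff_left : ContDiff ℝ 1 k
  contDiff_right : ContDiff ℝ 1 l
  partialD_left : ∀ p, partialD 0 k p = c p.1 * k p - partialD 1 l p
  partialD_right : ∀ p, partialD 0 l p = -c p.1 * l p - partialD 1 k p
  diag : ∀ x, l (x, x) = k (x, x) - c x
  antidiag : ∀ x, l (x, -x) = -k (x, -x)

variable {k m : ℝ × ℝ → ℝ} {f g : ℝ × ℝ → ℝ}

@[fun_prop]
theorem continuous_inX_volterra (hk : Continuous k) (hf : Continuous f) :
    Continuous (inX (volterra k) f) := by
  unfold inX volterra
  fun_prop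

@[fun_prop]
theorem continuous_inY_volterra (hk : Continuous k) (hf : Continuous f) :
    Continuous (inY (volterra k) f) := by
  unfold inY volterra
  fun_prop

theorem volterra_add (hk : Continuous k) {f g : ℝ → ℝ} (hf : Continuous f) (hg : Continuous g) :
    volterra k (fun t => f t + g t) = fun x => volterra k f x + volterra k g x := by
  funext x
  simp only [volterra, mul_add]
  rw [integral_add (Continuous.intervalIntegrable (by fun_prop) _ _)
    (Continuous.intervalIntegrable (by fun_prop) _ _)]
  ring

theorem volterra_const_mul (k : ℝ × ℝ → ℝ) (a : ℝ) (f : ℝ → ℝ) :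
    volterra k (fun t => a * f t) = fun x => a * volterra k f x := by
  funext x
  simp only [volterra, mul_left_comm _ a, intervalIntegral.integral_const_mul, mul_add]

theorem planeVolterra_add (hk : Continuous k) (hm : Continuous m) (hf : Continuous f)
    (hg : Continuous g) (p : ℝ × ℝ) :
    planeVolterra k m (fun q => f q + g q) p = planeVolterra k m f p + planeVolterra k m g p := by
  have inner : inY (volterra m) (fun q => f q + g q)
      = fun q => inY (volterra m) f q + inY (volterra m) g q :=
    funext fun q => congrFun (volterra_add hm (f := fun s => f (q.1, s))
      (g := fun s => g (q.1, s)) (by fun_prop) (by fun_prop)) q.2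
  rw [planeVolterra, inner]
  exact congrFun (volterra_add hk (f := fun s => inY (volterra m) f (s, p.2))
    (g := fun s => inY (volterra m) g (s, p.2)) (by fun_prop) (by fun_prop)) p.1

variable {c c₁ c₂ : ℝ → ℝ} {l k₁ l₁ k₂ l₂ fx fy : ℝ × ℝ → ℝ}

namespace IsDarbouxPair

theorem symm (h : IsDarbouxPair c k l) : IsDarbouxPair (-c) l k where
  contDiff_left := h.contDiff_right
  contDiff_right := h.contDiff_left
  partialD_left := h.partialD_right
  partialD_right p := by simpa using h.partialD_left p
  diag x := by simp [h.diag x]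
  antidiag x := by simp [h.antidiag x]

theorem continuous_coeff (h : IsDarbouxPair c k l) : Continuous c := by
  have hk := h.contDiff_left.continuous
  have hl := h.contDiff_right.continuous
  rw [funext fun x => eq_sub_of_add_eq' (eq_sub_iff_add_eq.1 (h.diag x))]
  fun_prop

theorem hasDerivAt_volterra (h : IsDarbouxPair c k l) {f f' : ℝ → ℝ}
    (hf : ∀ t, HasDerivAt f (f' t) t) (hf' : Continuous f') (x : ℝ) :
    HasDerivAt (volterra k f) (c x * volterra k f x + volterra l f' x) x := by
  have hfc : Continuous f := continuous_iff_continuousAt.2 fun t => (hf t).continuousAt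
  have hc := h.continuous_coeff
  have hk := h.contDiff_left.continuous
  have hlt : Continuous (partialD 1 l) := continuous_partialD h.contDiff_right 1
  have kernel_derivative (p : ℝ × ℝ) : HasDerivAt (fun s => k (s, p.2) * f p.2)
      ((c p.1 * k p - partialD 1 l p) * f p.2) p.1 :=
    h.partialD_left p ▸ ((hasContinuousPartials_partialD h.contDiff_left).fst p).mul_const _
  have leibniz := hasDerivAt_integral_moving (g := fun p => k p * f p.2) (by fun_prop)
    (by fun_prop) kernel_derivative (hasDerivAt_neg x) (hasDerivAt_id x)
  have by_parts : ∫ t in (-x)..x, l (x, t) * f' t = l (x, x) * f x - l (x, -x) * f (-x)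
      - ∫ t in (-x)..x, partialD 1 l (x, t) * f t :=
    integral_mul_deriv_eq_deriv_mul
      (fun t _ => (hasContinuousPartials_partialD h.contDiff_right).snd (x, t)) (fun t _ => hf t)
      (Continuous.intervalIntegrable (by fun_prop) _ _) (hf'.intervalIntegrable _ _)
  have split : ∫ t in (-x)..x, (c x * k (x, t) - partialD 1 l (x, t)) * f t
      = c x * (∫ t in (-x)..x, k (x, t) * f t) - ∫ t in (-x)..x, partialD 1 l (x, t) * f t := by
    rw [← intervalIntegral.integral_const_mul, ← integral_sub
      (Continuous.intervalIntegrable (by fun_prop) _ _)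
      (Continuous.intervalIntegrable (by fun_prop) _ _)]
    exact integral_congr fun t _ => by ring
  refine ((hf x).add leibniz).congr_deriv ?_
  simp only [volterra, id, smul_eq_mul]
  rw [by_parts, split, h.antidiag, h.diag]
  ring

theorem hasContinuousPartials_inX (h : IsDarbouxPair c k l) (hf : HasContinuousPartials f fx fy) :
    HasContinuousPartials (inX (volterra k) f)
      (fun p => c p.1 * inX (volterra k) f p + inX (volterra l) fx p) (inX (volterra k) fy) := by
  have hc := h.continuous_coeff
  have hk := h.contDiff_left.continuous
  have hl := h.contDiff_right.continuous
  have hfc := hf.continuous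
  have hfx := hf.continuous_fst
  have hfy := hf.continuous_snd
  refine ⟨fun p => ?_, fun p => ?_, by fun_prop, by fun_prop⟩
  · exact h.hasDerivAt_volterra (fun t => hf.fst (t, p.2)) (by fun_prop) p.1
  · exact (hf.snd p).add (hasDerivAt_integral_param (g := fun q => k (p.1, q.2) * f (q.2, q.1))
      (by fun_prop) (g' := fun q => k (p.1, q.2) * fy (q.2, q.1)) (by fun_prop)
      (fun q => (hf.snd (q.2, q.1)).const_mul (k (p.1, q.2))) (-p.1) p.1 p.2)

theorem hasContinuousPartials_inY (h : IsDarbouxPair c k l) (hf : HasContinuousPartials f fx fy) :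
    HasContinuousPartials (inY (volterra k) f) (inY (volterra k) fx)
      (fun p => c p.2 * inY (volterra k) f p + inY (volterra l) fy p) :=
  (h.hasContinuousPartials_inX hf.comp_swap).comp_swap

theorem hasContinuousPartials_planeVolterra (h₁ : IsDarbouxPair c₁ k₁ l₁)
    (h₂ : IsDarbouxPair c₂ k₂ l₂) (hf : HasContinuousPartials f fx fy) :
    HasContinuousPartials (planeVolterra k₁ k₂ f)
      (fun p => c₁ p.1 * planeVolterra k₁ k₂ f p + planeVolterra l₁ k₂ fx p)
      (fun p => c₂ p.2 * planeVolterra k₁ k₂ f p + planeVolterra k₁ l₂ fy p) := by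
  have hk₁ := h₁.contDiff_left.continuous
  have hk₂ := h₂.contDiff_left.continuous
  have hl₂ := h₂.contDiff_right.continuous
  have hfc := hf.continuous
  have hfy := hf.continuous_snd
  have linear (p : ℝ × ℝ) : c₂ p.2 * planeVolterra k₁ k₂ f p + planeVolterra k₁ l₂ fy p
      = inX (volterra k₁) (fun q => c₂ q.2 * inY (volterra k₂) f q + inY (volterra l₂) fy q) p := by
    have sum := volterra_add hk₁ (f := fun s => c₂ p.2 * inY (volterra k₂) f (s, p.2))
      (g := fun s => inY (volterra l₂) fy (s, p.2)) (by fun_prop) (by fun_prop)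
    rw [volterra_const_mul] at sum
    exact (congrFun sum p.1).symm
  rw [funext linear]
  exact h₁.hasContinuousPartials_inX (h₂.hasContinuousPartials_inY hf)

theorem contDiff_one_planeVolterra (h₁ : IsDarbouxPair c₁ k₁ l₁) (h₂ : IsDarbouxPair c₂ k₂ l₂)
    (hf : ContDiff ℝ 1 f) : ContDiff ℝ 1 (planeVolterra k₁ k₂ f) :=
  (h₁.hasContinuousPartials_planeVolterra h₂ (hasContinuousPartials_partialD hf)).contDiff_one

theorem contDiff_two_planeVolterra (h₁ : IsDarbouxPair c₁ k₁ l₁) (h₂ : IsDarbouxPair c₂ k₂ l₂)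
    (hc₁ : ContDiff ℝ 1 c₁) (hc₂ : ContDiff ℝ 1 c₂) (hf : ContDiff ℝ 2 f) :
    ContDiff ℝ 2 (planeVolterra k₁ k₂ f) := by
  have hf₁ : ContDiff ℝ 1 f := hf.of_le one_le_two
  have hV := h₁.contDiff_one_planeVolterra h₂ hf₁
  have hfi (i) : ContDiff ℝ 1 (partialD i f) := contDiff_partialD (n := 1) (mod_cast hf) i
  exact_mod_cast (h₁.hasContinuousPartials_planeVolterra h₂
    (hasContinuousPartials_partialD hf₁)).contDiff_succ (n := 1)
    (((hc₁.comp contDiff_fst).mul hV).add (h₁.symm.contDiff_one_planeVolterra h₂ (hfi 0)))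
    (((hc₂.comp contDiff_snd).mul hV).add (h₁.contDiff_one_planeVolterra h₂.symm (hfi 1)))

end IsDarbouxPair

end Volterra

section Supercharges

/-- The separable superpotential `χ(x₁,x₂) = χ₁(x₁) + χ₂(x₂)`. -/
def separable (χ₁ χ₂ : ℝ → ℝ) (p : ℝ × ℝ) : ℝ :=
  χ₁ p.1 + χ₂ p.2

variable {χ₁ χ₂ : ℝ → ℝ} {χ χ' f : ℝ × ℝ → ℝ} {k₁ l₁ k₂ l₂ : ℝ × ℝ → ℝ} {p : ℝ × ℝ}
  {i j : Fin 2}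

@[simp]
theorem partialD_zero_separable (χ₁ χ₂ : ℝ → ℝ) (p : ℝ × ℝ) :
    partialD 0 (separable χ₁ χ₂) p = deriv χ₁ p.1 := by
  simp [partialD_zero, separable]

@[simp]
theorem partialD_one_separable (χ₁ χ₂ : ℝ → ℝ) (p : ℝ × ℝ) :
    partialD 1 (separable χ₁ χ₂) p = deriv χ₂ p.2 := by
  simp [partialD_one, separable]

theorem qMinus_zero_planeVolterra (h₁ : IsDarbouxPair (deriv χ₁) k₁ l₁)
    {c₂ : ℝ → ℝ} (h₂ : IsDarbouxPair c₂ k₂ l₂) (hf : ContDiff ℝ 1 f) :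
    qMinus (separable χ₁ χ₂) 0 (planeVolterra l₁ k₂ f) = planeVolterra k₁ k₂ (partialD 0 f) := by
  funext p
  rw [qMinus, (h₁.symm.hasContinuousPartials_planeVolterra h₂
    (hasContinuousPartials_partialD hf)).partialD_zero, partialD_zero_separable]
  simp

theorem qPlus_zero_planeVolterra (h₁ : IsDarbouxPair (deriv χ₁) k₁ l₁)
    {c₂ : ℝ → ℝ} (h₂ : IsDarbouxPair c₂ k₂ l₂) (hf : ContDiff ℝ 1 f) :
    qPlus (separable χ₁ χ₂) 0 (planeVolterra k₁ k₂ f) = -planeVolterra l₁ k₂ (partialD 0 f) := by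
  funext p
  rw [qPlus, (h₁.hasContinuousPartials_planeVolterra h₂
    (hasContinuousPartials_partialD hf)).partialD_zero, partialD_zero_separable]
  simp

theorem qMinus_one_planeVolterra {c₁ : ℝ → ℝ} (h₁ : IsDarbouxPair c₁ k₁ l₁)
    (h₂ : IsDarbouxPair (deriv χ₂) k₂ l₂) (hf : ContDiff ℝ 1 f) :
    qMinus (separable χ₁ χ₂) 1 (planeVolterra k₁ l₂ f) = planeVolterra k₁ k₂ (partialD 1 f) := by
  funext p
  rw [qMinus, (h₁.hasContinuousPartials_planeVolterra h₂.symm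
    (hasContinuousPartials_partialD hf)).partialD_one, partialD_one_separable]
  simp

theorem qPlus_one_planeVolterra {c₁ : ℝ → ℝ} (h₁ : IsDarbouxPair c₁ k₁ l₁)
    (h₂ : IsDarbouxPair (deriv χ₂) k₂ l₂) (hf : ContDiff ℝ 1 f) :
    qPlus (separable χ₁ χ₂) 1 (planeVolterra k₁ k₂ f) = -planeVolterra k₁ l₂ (partialD 1 f) := by
  funext p
  rw [qPlus, (h₁.hasContinuousPartials_planeVolterra h₂
    (hasContinuousPartials_partialD hf)).partialD_one, partialD_one_separable]
  simp

theorem H0_separable_planeVolterra (h₁ : IsDarbouxPair (deriv χ₁) k₁ l₁)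
    (h₂ : IsDarbouxPair (deriv χ₂) k₂ l₂) (hf : ContDiff ℝ 2 f) (p : ℝ × ℝ) :
    H0 (separable χ₁ χ₂) (planeVolterra l₁ l₂ f) p = -planeVolterra l₁ l₂ (laplace f) p := by
  have hf₁ : ContDiff ℝ 1 f := hf.of_le one_le_two
  have hfi (i) : ContDiff ℝ 1 (partialD i f) := contDiff_partialD (n := 1) (mod_cast hf) i
  have laplace_eq :
      laplace f = fun q => partialD 0 (partialD 0 f) q + partialD 1 (partialD 1 f) q :=
    funext fun q => Fin.sum_univ_two _
  rw [laplace_eq, planeVolterra_add h₁.contDiff_right.continuous h₂.contDiff_right.continuous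
    (continuous_partialD (hfi 0) 0) (continuous_partialD (hfi 1) 1), H0, Fin.sum_univ_two,
    qMinus_zero_planeVolterra h₁ h₂.symm hf₁, qPlus_zero_planeVolterra h₁ h₂.symm (hfi 0),
    qMinus_one_planeVolterra h₁.symm h₂ hf₁, qPlus_one_planeVolterra h₁.symm h₂ (hfi 1)]
  simp only [Pi.neg_apply]
  ring

theorem qMinus_neg (χ : ℝ × ℝ → ℝ) (i : Fin 2) (f : ℝ × ℝ → ℝ) :
    qMinus χ i (-f) = -qMinus χ i f := by
  funext p
  simp only [qMinus, partialD_neg, Pi.neg_apply]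
  ring

theorem qPlus_neg (χ : ℝ × ℝ → ℝ) (i : Fin 2) (f : ℝ × ℝ → ℝ) :
    qPlus χ i (-f) = -qPlus χ i f := by
  funext p
  simp only [qPlus, partialD_neg, Pi.neg_apply]
  ring

theorem qMinus_congr (h : partialD i χ = partialD i χ') (f : ℝ × ℝ → ℝ) :
    qMinus χ i f = qMinus χ' i f := by
  unfold qMinus
  rw [h]

theorem qPlus_congr (h : partialD i χ = partialD i χ') (f : ℝ × ℝ → ℝ) :
    qPlus χ i f = qPlus χ' i f := by
  unfold qPlus
  rw [h]

theorem qMinus_eq_neg_qPlus (h : partialD i χ = -partialD i χ') (f : ℝ × ℝ → ℝ) :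
    qMinus χ i f = -qPlus χ' i f := by
  funext p
  simp only [qMinus, qPlus, h, Pi.neg_apply]
  ring

theorem qPlus_eq_neg_qMinus (h : partialD i χ = -partialD i χ') (f : ℝ × ℝ → ℝ) :
    qPlus χ i f = -qMinus χ' i f := by
  funext p
  simp only [qMinus, qPlus, h, Pi.neg_apply]
  ring

theorem pPlus_zero (χ f : ℝ × ℝ → ℝ) : pPlus χ 0 f = qMinus χ 1 f := by
  funext p
  simp [pPlus, eps]

theorem pPlus_one (χ f : ℝ × ℝ → ℝ) : pPlus χ 1 f = -qMinus χ 0 f := by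
  funext p
  simp [pPlus, eps]

theorem pMinus_zero (χ f : ℝ × ℝ → ℝ) : pMinus χ 0 f = qPlus χ 1 f := by
  funext p
  simp [pMinus, eps]

theorem pMinus_one (χ f : ℝ × ℝ → ℝ) : pMinus χ 1 f = -qPlus χ 0 f := by
  funext p
  simp [pMinus, eps]

theorem qPlus_qMinus_eq_of_partialD_neg (h : partialD i χ = -partialD i χ') (f : ℝ × ℝ → ℝ) :
    qPlus χ i (qMinus χ i f) = qMinus χ' i (qPlus χ' i f) := by
  rw [qPlus_eq_neg_qMinus h, qMinus_eq_neg_qPlus h, qMinus_neg, neg_neg]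

theorem qPlus_qMinus_congr (h : partialD i χ = partialD i χ') (f : ℝ × ℝ → ℝ) :
    qPlus χ i (qMinus χ i f) = qPlus χ' i (qMinus χ' i f) := by
  rw [qPlus_congr h, qMinus_congr h]

theorem H2_separable (χ₁ χ₂ : ℝ → ℝ) : H2 (separable χ₁ χ₂) = H0 (separable (-χ₁) (-χ₂)) := by
  funext f p
  rw [H2, H0, Fin.sum_univ_two, Fin.sum_univ_two, pMinus_zero, pMinus_one, pPlus_zero, pPlus_one,
    qMinus_neg, neg_neg, add_comm,
    qPlus_qMinus_eq_of_partialD_neg (i := 0) (χ' := separable χ₁ χ₂) (by ext; simp),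
    qPlus_qMinus_eq_of_partialD_neg (i := 1) (χ' := separable χ₁ χ₂) (by ext; simp)]

theorem H1entry_zero_zero (χ₁ χ₂ : ℝ → ℝ) :
    H1entry (separable χ₁ χ₂) 0 0 = H0 (separable (-χ₁) χ₂) := by
  funext f p
  rw [H1entry, H0, Fin.sum_univ_two, pPlus_zero, pMinus_zero,
    qPlus_qMinus_eq_of_partialD_neg (i := 0) (χ' := separable χ₁ χ₂) (by ext; simp),
    qPlus_qMinus_congr (i := 1) (χ := separable (-χ₁) χ₂) (χ' := separable χ₁ χ₂)
      (by ext; simp)]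

theorem H1entry_one_one (χ₁ χ₂ : ℝ → ℝ) :
    H1entry (separable χ₁ χ₂) 1 1 = H0 (separable χ₁ (-χ₂)) := by
  funext f p
  rw [H1entry, H0, Fin.sum_univ_two, pPlus_one, pMinus_one, qPlus_neg, neg_neg, add_comm,
    qPlus_qMinus_congr (i := 0) (χ := separable χ₁ (-χ₂)) (χ' := separable χ₁ χ₂)
      (by ext; simp),
    qPlus_qMinus_eq_of_partialD_neg (i := 1) (χ' := separable χ₁ χ₂) (by ext; simp)]

theorem partialD_add_partialD_separable_mul (hij : i ≠ j) {g : ℝ × ℝ → ℝ}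
    (hg : DifferentiableAt ℝ g p) (hf : DifferentiableAt ℝ f p) :
    partialD i (fun q => g q + partialD j (separable χ₁ χ₂) q * f q) p
      = partialD i g p + partialD j (separable χ₁ χ₂) p * partialD i f p := by
  fin_cases i <;> fin_cases j <;>
    simp only [Fin.zero_eta, Fin.mk_one, ne_eq, not_true_eq_false, partialD_zero_separable,
      partialD_one_separable] at hij ⊢
  · rw [partialD_zero]
    exact ((hasDerivAt_partialD_zero hg).add
      ((hasDerivAt_partialD_zero hf).const_mul (deriv χ₂ p.2))).deriv
  · rw [partialD_one]
    exact ((hasDerivAt_partialD_one hg).add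
      ((hasDerivAt_partialD_one hf).const_mul (deriv χ₁ p.1))).deriv

theorem qMinus_qPlus_comm (hij : i ≠ j) (hf : ContDiffAt ℝ 2 f p) :
    qMinus (separable χ₁ χ₂) i (qPlus (separable χ₁ χ₂) j f) p
      = qPlus (separable χ₁ χ₂) j (qMinus (separable χ₁ χ₂) i f) p := by
  have hf₁ : DifferentiableAt ℝ f p := hf.differentiableAt two_ne_zero
  have hfi (i) : DifferentiableAt ℝ (partialD i f) p :=
    (contDiffAt_partialD (n := 1) (mod_cast hf) i).differentiableAt one_ne_zero
  have left : partialD i (qPlus (separable χ₁ χ₂) j f) p = -partialD i (partialD j f) p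
      + partialD j (separable χ₁ χ₂) p * partialD i f p :=
    (partialD_add_partialD_separable_mul hij (hfi j).neg hf₁).trans
      (by rw [partialD_neg, Pi.neg_apply])
  have right : partialD j (qMinus (separable χ₁ χ₂) i f) p = partialD j (partialD i f) p
      + partialD i (separable χ₁ χ₂) p * partialD j f p :=
    partialD_add_partialD_separable_mul hij.symm (hfi i) hf₁
  rw [qMinus, left, qPlus, qPlus, right, qMinus, partialD_comm hf i j]
  ring

theorem H1entry_zero_one (hf : ContDiffAt ℝ 2 f p) : H1entry (separable χ₁ χ₂) 0 1 f p = 0 := by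
  rw [H1entry, pPlus_one, pMinus_zero, qPlus_neg, qMinus_qPlus_comm zero_ne_one hf]
  exact add_neg_cancel _

theorem H1entry_one_zero (hf : ContDiffAt ℝ 2 f p) : H1entry (separable χ₁ χ₂) 1 0 f p = 0 := by
  rw [H1entry, pPlus_zero, pMinus_one, qMinus_qPlus_comm one_ne_zero hf]
  exact add_neg_cancel _

theorem H0_eq_of_eventuallyEq {χ χ' f g : ℝ × ℝ → ℝ} (hχ : χ =ᶠ[𝓝 p] χ') (hf : f =ᶠ[𝓝 p] g) :
    H0 χ f p = H0 χ' g p := by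
  refine Finset.sum_congr rfl fun k _ => ?_
  have hχk := partialD_eventuallyEq hχ k
  have inner : qMinus χ k f =ᶠ[𝓝 p] qMinus χ' k g :=
    (partialD_eventuallyEq hf k).add (hχk.mul hf)
  exact ((partialD_eventuallyEq inner k).neg.add (hχk.mul inner)).eq_of_nhds

end Supercharges

section DarbouxPartner

variable {χ q : ℝ → ℝ} {c : ℝ} {k W : ℝ × ℝ → ℝ}

theorem continuous_potential (hχ : ContDiff ℝ 2 χ) : Continuous (potential χ) :=
  ((ContDiff.deriv' (n := 1) hχ).continuous_deriv le_rfl).add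
    ((hχ.continuous_deriv one_le_two).pow 2)

theorem hasDerivAt_exp_comp (hχ : ContDiff ℝ 2 χ) (x : ℝ) :
    HasDerivAt (fun x => Real.exp (χ x)) (deriv χ x * Real.exp (χ x)) x := by
  simpa only [mul_comm] using (hχ.differentiable two_ne_zero x).hasDerivAt.exp

theorem hasDerivAt_deriv_mul_exp_comp (hχ : ContDiff ℝ 2 χ) (x : ℝ) :
    HasDerivAt (fun x => deriv χ x * Real.exp (χ x)) (potential χ x * Real.exp (χ x)) x := by
  refine (((ContDiff.deriv' (n := 1) hχ).differentiable one_ne_zero x).hasDerivAt.mul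
    (hasDerivAt_exp_comp hχ x)).congr_deriv ?_
  rw [potential]
  ring

namespace IsGoursatIntegral

theorem hasContinuousPartials (hq : Continuous q) (hW : IsGoursatIntegral q c W) :
    HasContinuousPartials W
      (fun p => 1 / 2 * q p.1 + ∫ β in (0 : ℝ)..p.2, q (p.1 + β) * W (p.1, β))
      (fun p => ∫ α in (0 : ℝ)..p.1, q (α + p.2) * W (α, p.2)) := by
  have hWc := hW.continuous
  have rect := hasContinuousPartials_rectIntegral (φ := fun z => q (z.1 + z.2) * W z)
    (by fun_prop)
  have W_eq : W = goursatOperator q c W := funext hW.eq_goursatOperator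
  refine ⟨fun p => HasDerivAt.congr_of_eventuallyEq ?_ (.of_forall fun _ => congrFun W_eq _),
    fun p => HasDerivAt.congr_of_eventuallyEq ?_ (.of_forall fun _ => congrFun W_eq _),
    by fun_prop, by fun_prop⟩
  · exact (((hasDerivAt_integral_right hq 0 p.1).const_mul (1 / 2)).const_add c).add (rect.fst p)
  · exact (rect.snd p).const_add (c + 1 / 2 * ∫ s in (0 : ℝ)..p.1, q s)

theorem contDiff_one (hq : Continuous q) (hW : IsGoursatIntegral q c W) : ContDiff ℝ 1 W :=
  (hW.hasContinuousPartials hq).contDiff_one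

theorem apply_fst_zero (hW : IsGoursatIntegral q c W) (v : ℝ) : W (0, v) = c := by
  rw [hW.eq_goursatOperator]
  simp [goursatOperator]

end IsGoursatIntegral

/-- The potential vanishing on `u = 0` of the closed form
`W (e^χ)'(u+v) du + e^χ(u+v) ∂_v W dv`, for a solution `W` of the integral Goursat problem with
potential `χ'' + (χ')²`. -/
noncomputable def greenPotential (χ : ℝ → ℝ) (W : ℝ × ℝ → ℝ) (p : ℝ × ℝ) : ℝ :=
  ∫ α in (0 : ℝ)..p.1, W (α, p.2) * (deriv χ (α + p.2) * Real.exp (χ (α + p.2)))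

theorem hasContinuousPartials_greenPotential (hχ : ContDiff ℝ 2 χ)
    (hW : IsGoursatIntegral (potential χ) c W) :
    HasContinuousPartials (greenPotential χ W)
      (fun p => W p * (deriv χ (p.1 + p.2) * Real.exp (χ (p.1 + p.2))))
      (fun p => Real.exp (χ (p.1 + p.2)) * partialD 1 W p) := by
  have hq := continuous_potential hχ
  have hχ₀ := hχ.continuous
  have hχ₁ := hχ.continuous_deriv one_le_two
  have hWc := hW.continuous
  have partials := hW.hasContinuousPartials hq
  rw [partials.partialD_one]
  let weight_v (p : ℝ × ℝ) : ℝ := (∫ β in (0 : ℝ)..p.2, potential χ (β + p.1) * W (β, p.1))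
      * (deriv χ (p.2 + p.1) * Real.exp (χ (p.2 + p.1)))
    + W (p.2, p.1) * (potential χ (p.2 + p.1) * Real.exp (χ (p.2 + p.1)))
  have weight_v_continuous : Continuous weight_v := by fun_prop
  refine ⟨fun p => ?_, fun p => ?_, by fun_prop, by fun_prop⟩
  · exact hasDerivAt_integral_right (g := fun α => W (α, p.2)
      * (deriv χ (α + p.2) * Real.exp (χ (α + p.2)))) (by fun_prop) 0 p.1
  · refine (hasDerivAt_integral_param (g' := weight_v) (g := fun q => W (q.2, q.1)
      * (deriv χ (q.2 + q.1) * Real.exp (χ (q.2 + q.1)))) (by fun_prop) weight_v_continuous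
      (fun q => (partials.snd q.swap).mul
        ((hasDerivAt_deriv_mul_exp_comp hχ (q.2 + q.1)).comp_const_add _ _)) 0 p.1
      p.2).congr_deriv ?_
    refine congrFun (eq_of_hasDerivAt (a := 0) (g := fun u => Real.exp (χ (u + p.2))
        * ∫ α in (0 : ℝ)..u, potential χ (α + p.2) * W (α, p.2))
      (hasDerivAt_integral_right (by fun_prop : Continuous fun α => weight_v (p.2, α)) 0)
      (fun u => ?_) (by simp)) p.1
    refine (((hasDerivAt_exp_comp hχ (u + p.2)).comp_add_const _ _).mul
      (hasDerivAt_integral_right (g := fun α => potential χ (α + p.2) * W (α, p.2))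
        (by fun_prop) 0 u)).congr_deriv ?_
    simp only [weight_v]
    ring

/-- The kernel which forms a Darboux pair with `k` when `k`, read in characteristic coordinates,
solves the integral Goursat problem with potential `χ'' + (χ')²`. -/
noncomputable def darbouxPartner (χ : ℝ → ℝ) (k : ℝ × ℝ → ℝ) (p : ℝ × ℝ) : ℝ :=
  2 * Real.exp (-χ p.1) * greenPotential χ (fun z => k (z.1 + z.2, z.1 - z.2))
    ((p.1 + p.2) / 2, (p.1 - p.2) / 2) - k p

theorem half_add_add_half_sub (x t : ℝ) : (x + t) / 2 + (x - t) / 2 = x := by ring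

theorem half_add_sub_half_sub (x t : ℝ) : (x + t) / 2 - (x - t) / 2 = t := by ring

theorem exp_neg_mul_exp (x : ℝ) : Real.exp (-x) * Real.exp x = 1 := by
  rw [← Real.exp_add, neg_add_cancel, Real.exp_zero]

theorem darbouxPartner_diag (hχ : ContDiff ℝ 2 χ) (hχ₀ : χ 0 = 0)
    (hk : IsGoursatIntegral (potential χ) (deriv χ 0 / 2) fun z => k (z.1 + z.2, z.1 - z.2))
    (x : ℝ) : darbouxPartner χ k (x, x) = k (x, x) - deriv χ x := by
  have partials := hk.hasContinuousPartials (continuous_potential hχ)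
  have green := hasContinuousPartials_greenPotential hχ hk
  have on_axis : (fun x => 2 * greenPotential χ (fun z => k (z.1 + z.2, z.1 - z.2)) (x, 0))
      = fun x => 2 * k (x + 0, x - 0) * Real.exp (χ x) - deriv χ x * Real.exp (χ x) := by
    refine eq_of_hasDerivAt (a := 0) (fun x => (green.fst (x, 0)).const_mul 2) (fun x => ?_) ?_
    · refine ((((partials.fst (x, 0)).const_mul 2).mul (hasDerivAt_exp_comp hχ x)).sub
        (hasDerivAt_deriv_mul_exp_comp hχ x)).congr_deriv ?_
      simp only [integral_same, add_zero]
      ring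
    · have origin := hk.apply_fst_zero 0
      simp only [add_zero, sub_zero] at origin ⊢
      simp [greenPotential, origin, hχ₀, mul_div_cancel₀]
  have := congrFun on_axis x
  simp only [add_zero, sub_zero] at this
  simp only [darbouxPartner, sub_self, zero_div, add_self_div_two]
  linear_combination Real.exp (-χ x) * this + (2 * k (x, x) - deriv χ x) * exp_neg_mul_exp (χ x)

theorem contDiff_one_of_isGoursatIntegral (hq : Continuous q)
    (hk : IsGoursatIntegral q c fun z => k (z.1 + z.2, z.1 - z.2)) : ContDiff ℝ 1 k := by
  have h := (hasContinuousPartials_partialD (hk.contDiff_one hq)).characteristic.contDiff_one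
  simpa only [half_add_add_half_sub, half_add_sub_half_sub] using h

theorem hasContinuousPartials_darbouxPartner (hχ : ContDiff ℝ 2 χ)
    (hk : IsGoursatIntegral (potential χ) c fun z => k (z.1 + z.2, z.1 - z.2)) :
    HasContinuousPartials (darbouxPartner χ k)
      (fun p => -deriv χ p.1 * darbouxPartner χ k p - partialD 1 k p)
      (fun p => deriv χ p.1 * k p - partialD 0 k p) := by
  have k_partials := (hasContinuousPartials_partialD
    (hk.contDiff_one (continuous_potential hχ))).characteristic
  have green_partials := (hasContinuousPartials_greenPotential hχ hk).characteristic
  simp only [half_add_add_half_sub, half_add_sub_half_sub, smul_eq_mul] at k_partials green_partials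
  have exp_derivative (x : ℝ) : HasDerivAt (fun x => 2 * Real.exp (-χ x))
      (-deriv χ x * (2 * Real.exp (-χ x))) x :=
    (((hχ.differentiable two_ne_zero x).hasDerivAt.fun_neg.exp).const_mul 2).congr_deriv (by ring)
  have hk₁ : ContDiff ℝ 1 k := k_partials.contDiff_one
  have hχ₁ := hχ.continuous_deriv one_le_two
  have hl : Continuous (darbouxPartner χ k) := by
    have := green_partials.continuous
    have := hk₁.continuous
    have := hχ.continuous
    unfold darbouxPartner
    fun_prop
  let W_v (p : ℝ × ℝ) : ℝ :=
    partialD 1 (fun z => k (z.1 + z.2, z.1 - z.2)) ((p.1 + p.2) / 2, (p.1 - p.2) / 2)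
  refine ⟨fun p => ?_, fun p => ?_, by fun_prop, by fun_prop⟩
  · refine (((exp_derivative p.1).mul (green_partials.fst p)).sub (k_partials.fst p)).congr_deriv ?_
    rw [show partialD 1 k = _ from k_partials.partialD_one, darbouxPartner]
    linear_combination (deriv χ p.1 * k p + W_v p) * exp_neg_mul_exp (χ p.1)
  · refine (((green_partials.snd p).const_mul (2 * Real.exp (-χ p.1))).sub
      (k_partials.snd p)).congr_deriv ?_
    rw [show partialD 0 k = _ from k_partials.partialD_zero]
    linear_combination (deriv χ p.1 * k p - W_v p) * exp_neg_mul_exp (χ p.1)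

theorem isDarbouxPair_darbouxPartner (hχ : ContDiff ℝ 2 χ) (hχ₀ : χ 0 = 0)
    (hk : IsGoursatIntegral (potential χ) (deriv χ 0 / 2) fun z => k (z.1 + z.2, z.1 - z.2)) :
    IsDarbouxPair (deriv χ) k (darbouxPartner χ k) := by
  have partials := hasContinuousPartials_darbouxPartner hχ hk
  exact
    { contDiff_left := contDiff_one_of_isGoursatIntegral (continuous_potential hχ) hk
      contDiff_right := partials.contDiff_one
      partialD_left p := by rw [partials.partialD_one]; ring
      partialD_right p := by rw [partials.partialD_zero]
      diag := darbouxPartner_diag hχ hχ₀ hk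
      antidiag x := by simp [darbouxPartner, greenPotential] }

theorem IsDarbouxPair.right_eq (hχ : ContDiff ℝ 2 χ) {l : ℝ × ℝ → ℝ}
    (h : IsDarbouxPair (deriv χ) k l) (p : ℝ × ℝ) :
    l p = -Real.exp (-χ p.1) * ((∫ s in (-p.2)..p.1, partialD 1 k (s, p.2) * Real.exp (χ s))
      + k (-p.2, p.2) * Real.exp (χ (-p.2))) := by
  have hχ₀ := hχ.continuous
  have hkt := continuous_partialD h.contDiff_left 1
  have derivative (s : ℝ) : HasDerivAt (fun s => -(Real.exp (χ s) * l (s, p.2)))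
      (partialD 1 k (s, p.2) * Real.exp (χ s)) s := by
    refine ((hasDerivAt_exp_comp hχ s).mul ((hasContinuousPartials_partialD
      h.contDiff_right).fst (s, p.2))).neg.congr_deriv ?_
    rw [h.partialD_right]
    ring
  have antidiag := h.antidiag (-p.2)
  rw [neg_neg] at antidiag
  rw [integral_eq_sub_of_hasDerivAt (fun s _ => derivative s)
    (Continuous.intervalIntegrable (by fun_prop) _ _), antidiag]
  linear_combination -l p * exp_neg_mul_exp (χ p.1)

end DarbouxPartner

section GoursatSolution

variable {a c r : ℝ} {q : ℝ → ℝ} {K : ℝ → ℝ → ℝ} {W : ℝ × ℝ → ℝ} {p : ℝ × ℝ}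

theorem abs_half_add_add_abs_half_sub (x t : ℝ) :
    |(x + t) / 2| + |(x - t) / 2| = max |x| |t| := by
  grind

theorem characteristic_mem_square (hp : p ∈ diamond r) (hra : r < a) :
    (p.1 + p.2, p.1 - p.2) ∈ Ioo (-a) a ×ˢ Ioo (-a) a :=
  ⟨abs_lt.1 ((abs_add_le_of_mem_diamond hp).trans_lt hra),
    abs_lt.1 (((abs_sub _ _).trans hp).trans_lt hra)⟩

theorem mk_mem_diamond_of_mem_uIcc_fst (hp : p ∈ diamond r) {α : ℝ} (hα : α ∈ uIcc 0 p.1) :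
    (α, p.2) ∈ diamond r :=
  mem_diamond_of_abs_le hp (abs_le_abs_of_mem_uIcc_zero hα) le_rfl

theorem mk_mem_diamond_of_mem_uIcc_snd (hp : p ∈ diamond r) {β : ℝ} (hβ : β ∈ uIcc 0 p.2) :
    (p.1, β) ∈ diamond r :=
  mem_diamond_of_abs_le hp le_rfl (abs_le_abs_of_mem_uIcc_zero hβ)

theorem mem_nhds_diamond {x t : ℝ} (hx : |x| < r) (ht : |t| < r) :
    diamond r ∈ 𝓝 ((x + t) / 2, (x - t) / 2) := by
  have h : |(x + t) / 2| + |(x - t) / 2| < r :=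
    (abs_half_add_add_abs_half_sub x t).trans_lt (max_lt hx ht)
  filter_upwards [(isOpen_lt (f := fun p : ℝ × ℝ => |p.1| + |p.2|) (by fun_prop)
    continuous_const).mem_nhds h] with p hp using le_of_lt hp

theorem IsGoursatIntegral.eq_goursatOperator_of_mem_diamond {q' : ℝ → ℝ}
    (hW : IsGoursatIntegral q' c W) (hq' : ∀ s, |s| ≤ r → q' s = q s) (hp : p ∈ diamond r) :
    W p = goursatOperator q c W p :=
  (hW.eq_goursatOperator p).trans (goursatOperator_congr hp hq' fun _ _ => rfl)

namespace IsGoursatSolution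

theorem contDiffAt_characteristic (hK : IsGoursatSolution a q K) (hp : p ∈ diamond r)
    (hra : r < a) : ContDiffAt ℝ 1 (fun z : ℝ × ℝ => K (z.1 + z.2) (z.1 - z.2)) p :=
  (hK.contDiffOn.contDiffAt ((isOpen_Ioo.prod isOpen_Ioo).mem_nhds
    (characteristic_mem_square hp hra))).comp (f := fun z : ℝ × ℝ => (z.1 + z.2, z.1 - z.2)) p
    (by fun_prop)

theorem continuousOn_diamond (hK : IsGoursatSolution a q K) (hra : r < a) :
    ContinuousOn (fun z : ℝ × ℝ => K (z.1 + z.2) (z.1 - z.2)) (diamond r) := fun _ hp =>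
  (hK.contDiffAt_characteristic hp hra).continuousAt.continuousWithinAt

theorem partialD_one_characteristic_fst_zero (hK : IsGoursatSolution a q K) {v : ℝ}
    (hv : v ∈ Ioo (-a) a) :
    partialD 1 (fun z : ℝ × ℝ => K (z.1 + z.2) (z.1 - z.2)) (0, v) = 0 := by
  have vanishing : (fun s => K (0 + s) (0 - s)) =ᶠ[𝓝 v] fun _ => 0 := by
    filter_upwards [isOpen_Ioo.mem_nhds hv] with s hs
    rw [zero_add, zero_sub, hK.antidiag s hs]
  rw [partialD_one, vanishing.deriv_eq, deriv_const]

theorem partialD_one_characteristic (hK : IsGoursatSolution a q K)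
    (hq : ContinuousOn q (Ioo (-a) a)) (hp : p ∈ diamond r) (hra : r < a) :
    partialD 1 (fun z : ℝ × ℝ => K (z.1 + z.2) (z.1 - z.2)) p
      = ∫ α in (0 : ℝ)..p.1, q (α + p.2) * K (α + p.2) (α - p.2) := by
  have mem_square : ∀ α ∈ uIcc 0 p.1, (α + p.2, α - p.2) ∈ Ioo (-a) a ×ˢ Ioo (-a) a :=
    fun α hα => characteristic_mem_square (mk_mem_diamond_of_mem_uIcc_fst hp hα) hra
  have integrand : ContinuousOn (fun α => q (α + p.2) * K (α + p.2) (α - p.2)) (uIcc 0 p.1) :=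
    (hq.comp (by fun_prop) fun α hα => (mem_square α hα).1).mul
      ((hK.continuousOn_diamond hra).comp (f := fun α => (α, p.2)) (by fun_prop)
        fun α hα => mk_mem_diamond_of_mem_uIcc_fst hp hα)
  have left_end := hK.partialD_one_characteristic_fst_zero (v := p.2)
    (by simpa using (mem_square 0 left_mem_uIcc).1)
  rw [integral_eq_sub_of_hasDerivAt
    (f := fun u => partialD 1 (fun z : ℝ × ℝ => K (z.1 + z.2) (z.1 - z.2)) (u, p.2))
    (fun α hα => ?_) integrand.intervalIntegrable, left_end, sub_zero]
  simpa only [partialD_one] using hK.pde α p.2 (mem_square α hα).1 (mem_square α hα).2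

theorem eq_goursatOperator (hK : IsGoursatSolution a q K) (hq : ContinuousOn q (Ioo (-a) a))
    (hp : p ∈ diamond r) (hra : r < a) :
    K (p.1 + p.2) (p.1 - p.2) = goursatOperator q 0 (fun z => K (z.1 + z.2) (z.1 - z.2)) p := by
  set F : ℝ × ℝ → ℝ := fun z => K (z.1 + z.2) (z.1 - z.2)
  have mem : ∀ β ∈ uIcc 0 p.2, (p.1, β) ∈ diamond r := fun β =>
    mk_mem_diamond_of_mem_uIcc_snd hp
  have contDiffAt : ∀ β ∈ uIcc 0 p.2, ContDiffAt ℝ 1 F (p.1, β) := fun β hβ =>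
    hK.contDiffAt_characteristic (mem β hβ) hra
  have integrable : IntervalIntegrable (fun β => partialD 1 F (p.1, β)) volume 0 p.2 :=
    ContinuousOn.intervalIntegrable fun β hβ =>
      ((contDiffAt_partialD (n := 0) (by simpa using contDiffAt β hβ) 1).continuousAt.comp
        (f := fun β => (p.1, β)) (by fun_prop)).continuousWithinAt
  have bottom : F (p.1, 0) = 1 / 2 * ∫ s in (0 : ℝ)..p.1, q s := by
    have hp₁ := characteristic_mem_square (mem 0 left_mem_uIcc) hra
    simp only [add_zero, sub_zero] at hp₁
    simpa only [F, add_zero, sub_zero] using hK.diag p.1 hp₁.1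
  have increment := integral_eq_sub_of_hasDerivAt (f := fun v => F (p.1, v))
    (fun β hβ => hasDerivAt_partialD_one ((contDiffAt β hβ).differentiableAt one_ne_zero))
    integrable
  rw [integral_congr fun β hβ => hK.partialD_one_characteristic hq (mem β hβ) hra, bottom]
    at increment
  rw [goursatOperator, zero_add]
  exact (sub_eq_iff_eq_add'.1 increment.symm)

theorem eqOn_diamond (hK : IsGoursatSolution a q K) (hq : ContinuousOn q (Ioo (-a) a))
    (hra : r < a) {q' : ℝ → ℝ} (hq' : ∀ s, |s| ≤ r → q' s = q s)
    (hW : IsGoursatIntegral q' 0 W) :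
    EqOn (fun z => K (z.1 + z.2) (z.1 - z.2)) W (diamond r) :=
  eqOn_diamond_of_eq_goursatOperator
    (hq.mono (Icc_subset_Ioo (neg_lt_neg hra) hra)) (hK.continuousOn_diamond hra)
    hW.continuous.continuousOn (fun _ hp => hK.eq_goursatOperator hq hp hra) fun _ =>
      hW.eq_goursatOperator_of_mem_diamond hq'

end IsGoursatSolution

/-- `W` is a solution of the integral form of the Goursat problem on the open diamond
`|u| + |v| < a`, given as a compatible family of solutions in the plane for continuous extensions
of the potential. -/
def IsGoursatIntegralOn (a : ℝ) (q : ℝ → ℝ) (c : ℝ) (W : ℝ × ℝ → ℝ) : Prop :=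
  ∀ r, 0 ≤ r → r < a → ∃ q' V, Continuous q' ∧ (∀ s, |s| ≤ r → q' s = q s) ∧
    IsGoursatIntegral q' c V ∧ EqOn W V (diamond r)

theorem exists_isGoursatIntegralOn (hq : ContinuousOn q (Ioo (-a) a)) (c : ℝ) :
    ∃ W, IsGoursatIntegralOn a q c W := by
  have hqr : ∀ {r}, r < a → ContinuousOn q (Icc (-r) r) := fun hra =>
    hq.mono (Icc_subset_Ioo (neg_lt_neg hra) hra)
  have local_solution : ∀ r, ∃ q' V, 0 ≤ r → r < a → Continuous q' ∧
      (∀ s, |s| ≤ r → q' s = q s) ∧ IsGoursatIntegral q' c V := fun r => by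
    by_cases hr : 0 ≤ r ∧ r < a
    · obtain ⟨q', hq', hqq', B, hB⟩ := exists_bounded_continuous_extension hr.1 (hqr hr.2)
      obtain ⟨V, hV⟩ := exists_isGoursatIntegral hq' hB c
      exact ⟨q', V, fun _ _ => ⟨hq', hqq', hV⟩⟩
    · exact ⟨0, 0, fun h₀ ha => absurd ⟨h₀, ha⟩ hr⟩
  choose q' V hV using local_solution
  refine ⟨fun p => V (|p.1| + |p.2|) p, fun r hr hra => ?_⟩
  obtain ⟨hq'r, hqr', hVr⟩ := hV r hr hra
  refine ⟨q' r, V r, hq'r, hqr', hVr, fun p (hp : |p.1| + |p.2| ≤ r) => ?_⟩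
  obtain ⟨-, hqρ, hVρ⟩ := hV (|p.1| + |p.2|) (by positivity) (hp.trans_lt hra)
  exact eqOn_diamond_of_eq_goursatOperator (hqr (hp.trans_lt hra)) hVρ.continuous.continuousOn
    hVr.continuous.continuousOn (fun _ => hVρ.eq_goursatOperator_of_mem_diamond hqρ)
    (fun _ => hVr.eq_goursatOperator_of_mem_diamond fun s hs => hqr' s (hs.trans hp))
    (le_refl (|p.1| + |p.2|))

theorem IsGoursatIntegral.hasDerivAt_partialD_one (hq : Continuous q)
    (hW : IsGoursatIntegral q c W) (p : ℝ × ℝ) :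
    HasDerivAt (fun u => partialD 1 W (u, p.2)) (q (p.1 + p.2) * W p) p.1 := by
  have := hW.continuous
  rw [(hW.hasContinuousPartials hq).partialD_one]
  exact hasDerivAt_integral_right (g := fun α => q (α + p.2) * W (α, p.2)) (by fun_prop) 0 p.1

theorem IsGoursatIntegralOn.exists_eventuallyEq (hW : IsGoursatIntegralOn a q c W) {x t : ℝ}
    (hx : x ∈ Ioo (-a) a) (ht : t ∈ Ioo (-a) a) :
    ∃ q' V, Continuous q' ∧ (∀ s, |s| ≤ |x| → q' s = q s) ∧ IsGoursatIntegral q' c V ∧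
      W =ᶠ[𝓝 ((x + t) / 2, (x - t) / 2)] V := by
  obtain ⟨r, hxtr, hra⟩ := exists_between (max_lt (abs_lt.2 hx) (abs_lt.2 ht))
  obtain ⟨hxr, htr⟩ := max_lt_iff.1 hxtr
  obtain ⟨q', V, hq', hqq', hV, hWV⟩ := hW r ((abs_nonneg x).trans hxr.le) hra
  exact ⟨q', V, hq', fun s hs => hqq' s (hs.trans hxr.le), hV,
    hWV.eventuallyEq_of_mem (mem_nhds_diamond hxr htr)⟩

theorem IsGoursatIntegralOn.isGoursatSolution (hW : IsGoursatIntegralOn a q 0 W) :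
    IsGoursatSolution a q fun x t => W ((x + t) / 2, (x - t) / 2) := by
  refine ⟨?_, fun u v hx ht => ?_, fun x hx => ?_, fun x hx => ?_⟩
  · rintro ⟨x, t⟩ ⟨hx, ht⟩
    obtain ⟨q', V, hq', -, hV, hWV⟩ := hW.exists_eventuallyEq hx ht
    exact ((((hV.contDiff_one hq').contDiffAt.congr_of_eventuallyEq hWV).comp
      (f := fun p : ℝ × ℝ => ((p.1 + p.2) / 2, (p.1 - p.2) / 2)) (x, t)
      (by fun_prop))).contDiffWithinAt
  · obtain ⟨q', V, hq', hqq', hV, hWV⟩ := hW.exists_eventuallyEq hx ht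
    have characteristic_coordinates : ∀ u v : ℝ,
        ((u + v + (u - v)) / 2, (u + v - (u - v)) / 2) = (u, v) := fun u v => by
      congr 1 <;> ring
    simp only [characteristic_coordinates] at hWV ⊢
    rw [← hqq' _ le_rfl, hWV.eq_of_nhds]
    refine (hV.hasDerivAt_partialD_one hq' (u, v)).congr_of_eventuallyEq ?_
    filter_upwards [(by fun_prop : ContinuousAt (fun s : ℝ => (s, v)) u).eventually
      (partialD_eventuallyEq hWV 1)] with s hs
    rw [← hs, partialD_one]
  · obtain ⟨q', V, -, hqq', hV, hWV⟩ := hW.exists_eventuallyEq hx hx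
    have hWx := hWV.eq_of_nhds
    simp only [add_self_div_two, sub_self, zero_div] at hWx ⊢
    rw [hWx, hV.eq_goursatOperator, goursatOperator, rectIntegral_snd_zero, zero_add, add_zero]
    exact congrArg _ (integral_congr fun s hs =>
      hqq' s (by simpa using abs_le_abs_of_mem_uIcc_zero hs))
  · obtain ⟨q', V, -, -, hV, hWV⟩ :=
      hW.exists_eventuallyEq hx (t := -x) ⟨neg_lt_neg hx.2, neg_lt.1 hx.1⟩
    rw [hWV.eq_of_nhds, add_neg_cancel, zero_div, hV.apply_fst_zero]

theorem exists_isGoursatSolution (hq : ContinuousOn q (Ioo (-a) a)) :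
    ∃ K, IsGoursatSolution a q K := by
  obtain ⟨W, hW⟩ := exists_isGoursatIntegralOn hq 0
  exact ⟨_, hW.isGoursatSolution⟩

theorem continuousOn_potential {χ : ℝ → ℝ} {s : Set ℝ} (hs : IsOpen s)
    (hχ : ContDiffOn ℝ 2 χ s) : ContinuousOn (potential χ) s :=
  have hχ' : ContDiffOn ℝ 1 (deriv χ) s := hχ.deriv_of_isOpen hs (by norm_num)
  (hχ'.continuousOn_deriv_of_isOpen hs le_rfl).add (hχ'.continuousOn.pow 2)

theorem isGoursatSolution_kernelK {χ : ℝ → ℝ} (hχ : ContDiffOn ℝ 2 χ (Ioo (-a) a)) :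
    IsGoursatSolution a (potential χ) (kernelK a χ) :=
  Classical.epsilon_spec (exists_isGoursatSolution (continuousOn_potential isOpen_Ioo hχ))

end GoursatSolution

section Extension

variable {E F : Type*} [NormedAddCommGroup E] [NormedSpace ℝ E] [FiniteDimensional ℝ E]
  [NormedAddCommGroup F] [NormedSpace ℝ F]

theorem exists_contDiff_extension {n : ℕ} {f : E → F} {s U : Set E} (hs : IsCompact s)
    (hU : IsOpen U) (hsU : s ⊆ U) (hf : ContDiffOn ℝ n f U) :
    ∃ g : E → F, ContDiff ℝ n g ∧ HasCompactSupport g ∧ g =ᶠ[𝓝ˢ s] f := by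
  obtain ⟨t, ht, hst, htU⟩ := exists_compact_between hs hU hsU
  obtain ⟨φ, hφs, hφt, -⟩ := exists_contMDiffMap_one_nhds_of_subset_interior (n := n)
    (modelWithCornersSelf ℝ E) hs.isClosed hst
  refine ⟨fun x => φ x • f x, contDiff_iff_contDiffAt.2 fun x => ?_,
    HasCompactSupport.intro ht fun x hx => by rw [hφt x hx, zero_smul], ?_⟩
  · by_cases hx : x ∈ U
    · exact φ.contMDiff.contDiff.contDiffAt.smul (hf.contDiffAt (hU.mem_nhds hx))
    · refine contDiffAt_const (c := 0).congr_of_eventuallyEq ?_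
      filter_upwards [ht.isClosed.isOpen_compl.mem_nhds fun h => hx (htU h)] with y hy
      rw [hφt y hy, zero_smul]
  · filter_upwards [hφs] with x hx
    rw [hx, one_smul]

end Extension

section TransmutationKernels

variable {a r : ℝ} {χ ψ : ℝ → ℝ}

theorem potential_eq_of_eventuallyEq {x : ℝ} (h : ψ =ᶠ[𝓝 x] χ) :
    potential ψ x = potential χ x := by
  rw [potential, potential, h.deriv.deriv_eq, h.deriv_eq]

theorem exists_abs_potential_le (hψ : ContDiff ℝ 2 ψ) (hψ_supp : HasCompactSupport ψ) :
    ∃ B, ∀ s, |potential ψ s| ≤ B :=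
  (hψ_supp.deriv.deriv.add (f' := fun x => deriv ψ x ^ 2) (hψ_supp.deriv.comp_left
    (g := fun y : ℝ => y ^ 2) (zero_pow two_ne_zero))).exists_bound_of_continuous
      (continuous_potential hψ)

theorem hConst_eq_deriv (hχ : DifferentiableAt ℝ χ 0) (hχ₀ : χ 0 = 0) : hConst χ = deriv χ 0 := by
  rw [hConst, hχ.hasDerivAt.exp.deriv, hχ₀, Real.exp_zero, one_mul]

theorem neg_mem_Ioo_neg_self {x : ℝ} (hx : x ∈ Ioo (-r) r) : -x ∈ Ioo (-r) r :=
  ⟨neg_lt_neg hx.2, neg_lt.1 hx.1⟩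

theorem kernelK_eqOn {W : ℝ × ℝ → ℝ} (hχ : ContDiffOn ℝ 2 χ (Ioo (-a) a)) (hra : r < a)
    (hψχ : ψ =ᶠ[𝓝ˢ (Icc (-r) r)] χ) (hW : IsGoursatIntegral (potential ψ) 0 W) :
    EqOn (Function.uncurry (kernelK a χ)) (fun p => W ((p.1 + p.2) / 2, (p.1 - p.2) / 2))
      (Ioo (-r) r ×ˢ Ioo (-r) r) := by
  rintro ⟨x, t⟩ ⟨hx, ht⟩
  have agree := (isGoursatSolution_kernelK hχ).eqOn_diamond
    (continuousOn_potential isOpen_Ioo hχ) hra (fun s hs => potential_eq_of_eventuallyEq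
      (hψχ.filter_mono (nhds_le_nhdsSet (abs_le.1 hs)))) hW
    (mem_of_mem_nhds (mem_nhds_diamond (abs_lt.2 hx) (abs_lt.2 ht)))
  simpa only [half_add_add_half_sub, half_add_sub_half_sub, Function.uncurry_apply_pair]
    using agree

theorem kernelKh_eqOn {K : ℝ × ℝ → ℝ}
    (hK : EqOn (Function.uncurry (kernelK a χ)) K (Ioo (-r) r ×ˢ Ioo (-r) r)) :
    EqOn (Function.uncurry (kernelKh a χ))
      (fun p => hConst χ / 2 + K p + hConst χ / 2 * oddPrimitive K p)
      (Ioo (-r) r ×ˢ Ioo (-r) r) := by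
  rintro ⟨x, t⟩ ⟨hx, ht⟩
  refine congrArg₂ (fun y z => hConst χ / 2 + y + hConst χ / 2 * z) (hK (x := (x, t)) ⟨hx, ht⟩)
    (integral_congr fun s hs => ?_)
  have hs := ordConnected_Ioo.uIcc_subset ht hx hs
  exact congrArg₂ (· - ·) (hK (x := (x, s)) ⟨hx, hs⟩)
    (hK (x := (x, -s)) ⟨hx, neg_mem_Ioo_neg_self hs⟩)

theorem IsDarbouxPair.kernelKtilde_eqOn {k l : ℝ × ℝ → ℝ} (h : IsDarbouxPair (deriv ψ) k l)
    (hψ : ContDiff ℝ 2 ψ) (hψχ : EqOn ψ χ (Ioo (-r) r))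
    (hk : EqOn (Function.uncurry (kernelKh a χ)) k (Ioo (-r) r ×ˢ Ioo (-r) r))
    (hk_antidiag : ∀ t, k (-t, t) = hConst χ / 2) :
    EqOn (Function.uncurry (kernelKtilde a χ)) l (Ioo (-r) r ×ˢ Ioo (-r) r) := by
  rintro ⟨x, t⟩ ⟨hx, ht⟩
  have hnt := neg_mem_Ioo_neg_self ht
  have derivative : ∀ s ∈ Ioo (-r) r,
      deriv (fun τ => kernelKh a χ s τ) t = partialD 1 k (s, t) := fun s hs => by
    rw [partialD_one]
    exact EventuallyEq.deriv_eq (eventually_of_mem (isOpen_Ioo.mem_nhds ht) fun τ hτ =>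
      hk (x := (s, τ)) ⟨hs, hτ⟩)
  rw [h.right_eq hψ, hk_antidiag, hψχ hx, hψχ hnt, Function.uncurry_apply_pair, kernelKtilde,
    integral_congr fun s hs => ?_]
  have hs := ordConnected_Ioo.uIcc_subset hnt hx hs
  simp only [derivative s hs, hψχ hs]

theorem exists_isDarbouxPair_eqOn_kernels (hχ : ContDiffOn ℝ 2 χ (Ioo (-a) a)) (hχ₀ : χ 0 = 0)
    (hr : 0 < r) (hra : r < a) : ∃ ψ k l, ContDiff ℝ 2 ψ ∧ EqOn ψ χ (Ioo (-r) r) ∧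
      IsDarbouxPair (deriv ψ) k l ∧
      EqOn (Function.uncurry (kernelKh a χ)) k (Ioo (-r) r ×ˢ Ioo (-r) r) ∧
      EqOn (Function.uncurry (kernelKtilde a χ)) l (Ioo (-r) r ×ˢ Ioo (-r) r) := by
  obtain ⟨ψ, hψ, hψ_supp, hψχ⟩ := exists_contDiff_extension (n := 2) isCompact_Icc isOpen_Ioo
    (Icc_subset_Ioo (neg_lt_neg hra) hra) hχ
  have eqOn : EqOn ψ χ (Ioo (-r) r) := fun x hx =>
    (hψχ.filter_mono (nhds_le_nhdsSet (Ioo_subset_Icc_self hx))).eq_of_nhds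
  have near_zero : ψ =ᶠ[𝓝 0] χ :=
    hψχ.filter_mono (nhds_le_nhdsSet ⟨neg_nonpos.2 hr.le, hr.le⟩)
  have hψ₀ : ψ 0 = 0 := near_zero.eq_of_nhds.trans hχ₀
  have hConst_eq : hConst χ = deriv ψ 0 := by
    rw [near_zero.deriv_eq, hConst_eq_deriv
      ((hψ.differentiable two_ne_zero 0).congr_of_eventuallyEq near_zero.symm) hχ₀]
  obtain ⟨B, hB⟩ := exists_abs_potential_le hψ hψ_supp
  obtain ⟨W, hW⟩ := exists_isGoursatIntegral (continuous_potential hψ) hB 0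
  have hW_cont := hW.continuous
  set K : ℝ × ℝ → ℝ := fun p => W ((p.1 + p.2) / 2, (p.1 - p.2) / 2) with hK
  have hKW : (fun z : ℝ × ℝ => K (z.1 + z.2, z.1 - z.2)) = W := by
    funext z
    simp only [hK]
    congr 1
    ext <;> ring
  have hk := kernelKh_eqOn (kernelK_eqOn hχ hra hψχ hW)
  have goursat := IsGoursatIntegral.add_oddPrimitive (continuous_potential hψ)
    (by fun_prop : Continuous K) (hKW ▸ hW) (hConst χ / 2)
  have pair := isDarbouxPair_darbouxPartner (k := fun p => hConst χ / 2 + K p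
    + hConst χ / 2 * oddPrimitive K p) hψ hψ₀ (hConst_eq ▸ goursat)
  exact ⟨ψ, _, _, hψ, eqOn, pair, hk, pair.kernelKtilde_eqOn hψ eqOn hk fun t => by
    simpa using goursat.apply_fst_zero (-t)⟩

end TransmutationKernels

section Locality

variable {χ₁ χ₂ : ℝ → ℝ} {k k' m m' f g : ℝ × ℝ → ℝ} {r r₁ r₂ : ℝ}

theorem volterra_congr {f g : ℝ → ℝ} {x : ℝ} (hk : ∀ t, |t| ≤ |x| → k (x, t) = k' (x, t))
    (hf : ∀ t, |t| ≤ |x| → f t = g t) : volterra k f x = volterra k' g x := by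
  refine congrArg₂ (· + ·) (hf x le_rfl) (integral_congr fun t ht => ?_)
  have ht : |t| ≤ |x| := abs_le.2 (ordConnected_Icc.uIcc_subset
    ⟨neg_le_neg (le_abs_self x), neg_le_abs x⟩ (abs_le.1 le_rfl) ht)
  exact congrArg₂ (· * ·) (hk t ht) (hf t ht)

theorem planeVolterra_congr {p : ℝ × ℝ} (hk : ∀ t, |t| ≤ |p.1| → k (p.1, t) = k' (p.1, t))
    (hm : ∀ t, |t| ≤ |p.2| → m (p.2, t) = m' (p.2, t))
    (hf : ∀ s t, |s| ≤ |p.1| → |t| ≤ |p.2| → f (s, t) = g (s, t)) :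
    planeVolterra k m f p = planeVolterra k' m' g p :=
  volterra_congr hk fun s hs => volterra_congr hm fun t ht => hf s t hs ht

theorem planeVolterra_eqOn (hk : EqOn k k' (Ioo (-r₁) r₁ ×ˢ Ioo (-r₁) r₁))
    (hm : EqOn m m' (Ioo (-r₂) r₂ ×ˢ Ioo (-r₂) r₂))
    (hf : EqOn f g (Ioo (-r₁) r₁ ×ˢ Ioo (-r₂) r₂)) :
    EqOn (planeVolterra k m f) (planeVolterra k' m' g) (Ioo (-r₁) r₁ ×ˢ Ioo (-r₂) r₂) := by
  rintro p ⟨h₁, h₂⟩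
  have mem {r x t : ℝ} (hx : x ∈ Ioo (-r) r) (ht : |t| ≤ |x|) : t ∈ Ioo (-r) r :=
    abs_lt.1 (ht.trans_lt (abs_lt.2 hx))
  exact planeVolterra_congr (fun _ ht => hk ⟨h₁, mem h₁ ht⟩) (fun _ ht => hm ⟨h₂, mem h₂ ht⟩)
    fun _ _ hs ht => hf ⟨mem h₁ hs, mem h₂ ht⟩

theorem IsRectSymmetric.planeVolterra_eqOn {Ω : Set (ℝ × ℝ)} (hs : IsRectSymmetric Ω)
    (hf : EqOn f g Ω) : EqOn (planeVolterra k m f) (planeVolterra k m g) Ω := fun p hp =>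
  planeVolterra_congr (fun _ _ => rfl) (fun _ _ => rfl) fun s t h₁ h₂ => hf (hs p hp s t h₁ h₂)

theorem IsRectSymmetric.exists_rect {Ω : Set (ℝ × ℝ)} (hs : IsRectSymmetric Ω) (hΩ : IsOpen Ω)
    {p : ℝ × ℝ} (hp : p ∈ Ω) : ∃ R₁ R₂ r₁ r₂ : ℝ, r₁ ∈ Ioo 0 R₁ ∧ r₂ ∈ Ioo 0 R₂ ∧
      p ∈ Ioo (-r₁) r₁ ×ˢ Ioo (-r₂) r₂ ∧ Icc (-R₁) R₁ ×ˢ Icc (-R₂) R₂ ⊆ Ω := by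
  have corner_mem : (|p.1|, |p.2|) ∈ Ω := hs p hp _ _ (abs_abs _).le (abs_abs _).le
  have shift_continuous : Continuous fun ε : ℝ => (|p.1| + ε, |p.2| + ε) := by fun_prop
  obtain ⟨ε, shift_mem, hε⟩ := (((hΩ.preimage shift_continuous).eventually_mem (x := 0)
    (by simpa using corner_mem)).filter_mono nhdsWithin_le_nhds |>.and
      (self_mem_nhdsWithin (s := Ioi (0 : ℝ)))).exists
  refine ⟨|p.1| + ε, |p.2| + ε, |p.1| + ε / 2, |p.2| + ε / 2, ⟨by positivity, by linarith⟩,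
    ⟨by positivity, by linarith⟩, ⟨abs_lt.1 (by linarith), abs_lt.1 (by linarith)⟩, ?_⟩
  rintro ⟨s, t⟩ ⟨hs', ht'⟩
  exact hs _ shift_mem s t ((abs_le.2 hs').trans (le_abs_self _))
    ((abs_le.2 ht').trans (le_abs_self _))

end Locality

section TransmutationKernel

variable {a a₁ a₂ : ℝ} {χ χ₁ χ₂ : ℝ → ℝ} {l l₁ l₂ : ℝ × ℝ → ℝ} {Ω : Set (ℝ × ℝ)}

/-- `l` is the kernel of a Volterra operator that transmutes `-f''` into `-f'' + (χ'² - χ'') f`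
on `(-a, a)`. As `χ` is arbitrary at and beyond `±a`, the Darboux system behind this property is
required only of global extensions of `χ` and `l` from each smaller interval and square. -/
def IsTransmutationKernel (a : ℝ) (χ : ℝ → ℝ) (l : ℝ × ℝ → ℝ) : Prop :=
  ∀ r ∈ Ioo 0 a, ∃ ψ k l', ContDiff ℝ 2 ψ ∧ EqOn ψ χ (Ioo (-r) r) ∧
    IsDarbouxPair (deriv ψ) k l' ∧ EqOn l l' (Ioo (-r) r ×ˢ Ioo (-r) r)

theorem isTransmutationKernel_kernelKtilde (hχ : ContDiffOn ℝ 2 χ (Ioo (-a) a)) (hχ₀ : χ 0 = 0) :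
    IsTransmutationKernel a χ (Function.uncurry (kernelKtilde a χ)) := fun _ hr =>
  let ⟨ψ, k, l, hψ, hψχ, pair, _, hl⟩ := exists_isDarbouxPair_eqOn_kernels hχ hχ₀ hr.1 hr.2
  ⟨ψ, k, l, hψ, hψχ, pair, hl⟩

theorem isTransmutationKernel_neg_kernelKh (hχ : ContDiffOn ℝ 2 χ (Ioo (-a) a)) (hχ₀ : χ 0 = 0) :
    IsTransmutationKernel a (-χ) (Function.uncurry (kernelKh a χ)) := fun _ hr =>
  let ⟨ψ, k, l, hψ, hψχ, pair, hk, _⟩ := exists_isDarbouxPair_eqOn_kernels hχ hχ₀ hr.1 hr.2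
  ⟨-ψ, l, k, hψ.neg, fun _ hx => congrArg Neg.neg (hψχ hx), deriv.neg' (f := ψ) ▸ pair.symm, hk⟩

theorem IsTransmutationKernel.contDiffAt_and_H0_planeVolterra
    (h₁ : IsTransmutationKernel a₁ χ₁ l₁) (h₂ : IsTransmutationKernel a₂ χ₂ l₂)
    (hΩ : IsOpen Ω) (hΩR : Ω ⊆ Icc (-a₁) a₁ ×ˢ Icc (-a₂) a₂) (hΩsymm : IsRectSymmetric Ω)
    {f : ℝ × ℝ → ℝ} (hf : ContDiffOn ℝ 2 f Ω) {p : ℝ × ℝ} (hp : p ∈ Ω) :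
    ContDiffAt ℝ 2 (planeVolterra l₁ l₂ f) p ∧
      H0 (separable χ₁ χ₂) (planeVolterra l₁ l₂ f) p = -planeVolterra l₁ l₂ (laplace f) p := by
  obtain ⟨R₁, R₂, r₁, r₂, hr₁, hr₂, hpr, hR⟩ := hΩsymm.exists_rect hΩ hp
  have corner := hΩR (hR (mk_mem_prod (right_mem_Icc.2 (neg_le_self (hr₁.1.trans hr₁.2).le))
    (right_mem_Icc.2 (neg_le_self (hr₂.1.trans hr₂.2).le))))
  obtain ⟨ψ₁, k₁, l₁', hψ₁, hψχ₁, pair₁, hl₁⟩ := h₁ r₁ ⟨hr₁.1, hr₁.2.trans_le corner.1.2⟩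
  obtain ⟨ψ₂, k₂, l₂', hψ₂, hψχ₂, pair₂, hl₂⟩ := h₂ r₂ ⟨hr₂.1, hr₂.2.trans_le corner.2.2⟩
  obtain ⟨g, hg, -, hgf⟩ := exists_contDiff_extension (n := 2) (isCompact_Icc.prod isCompact_Icc)
    hΩ hR hf
  have near : Ioo (-r₁) r₁ ×ˢ Ioo (-r₂) r₂ ∈ 𝓝 p := (isOpen_Ioo.prod isOpen_Ioo).mem_nhds hpr
  have f_near (q) (hq : q ∈ Ioo (-r₁) r₁ ×ˢ Ioo (-r₂) r₂) : f =ᶠ[𝓝 q] g :=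
    (hgf.filter_mono (nhds_le_nhdsSet (prod_mono
      (Ioo_subset_Icc_self.trans (Icc_subset_Icc (neg_le_neg hr₁.2.le) hr₁.2.le))
      (Ioo_subset_Icc_self.trans (Icc_subset_Icc (neg_le_neg hr₂.2.le) hr₂.2.le)) hq))).symm
  have volterra_near : planeVolterra l₁ l₂ f =ᶠ[𝓝 p] planeVolterra l₁' l₂' g :=
    eventually_of_mem near (planeVolterra_eqOn hl₁ hl₂ fun q hq => (f_near q hq).eq_of_nhds)
  have separable_near : separable χ₁ χ₂ =ᶠ[𝓝 p] separable ψ₁ ψ₂ :=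
    eventually_of_mem near fun q hq => (congrArg₂ (· + ·) (hψχ₁ hq.1) (hψχ₂ hq.2)).symm
  refine ⟨(pair₁.symm.contDiff_two_planeVolterra pair₂.symm (ContDiff.deriv' (n := 1) hψ₁).neg
    (ContDiff.deriv' (n := 1) hψ₂).neg hg).contDiffAt.congr_of_eventuallyEq volterra_near, ?_⟩
  rw [H0_eq_of_eventuallyEq separable_near volterra_near,
    H0_separable_planeVolterra pair₁ pair₂ hg, planeVolterra_eqOn hl₁ hl₂
      (fun q hq => laplace_eq_of_eventuallyEq (f_near q hq)) hpr]

theorem IsTransmutationKernel.contDiffAt_and_H0_planeVolterra_clm_comp {E : Type*}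
    [NormedAddCommGroup E] [NormedSpace ℝ E] (h₁ : IsTransmutationKernel a₁ χ₁ l₁)
    (h₂ : IsTransmutationKernel a₂ χ₂ l₂) (hΩ : IsOpen Ω)
    (hΩR : Ω ⊆ Icc (-a₁) a₁ ×ˢ Icc (-a₂) a₂) (hΩsymm : IsRectSymmetric Ω) (L : E →L[ℝ] ℝ)
    {w : ℝ × ℝ → E} (hw : ContDiffOn ℝ 2 w Ω) {p : ℝ × ℝ} (hp : p ∈ Ω) :
    ContDiffAt ℝ 2 (planeVolterra l₁ l₂ (L ∘ w)) p ∧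
      H0 (separable χ₁ χ₂) (planeVolterra l₁ l₂ (L ∘ w)) p
        = -planeVolterra l₁ l₂ (L ∘ laplace w) p := by
  have laplace_comp : EqOn (laplace (L ∘ w)) (L ∘ laplace w) Ω := fun q hq =>
    laplace_clm_comp L (hw.contDiffAt (hΩ.mem_nhds hq))
  rw [← hΩsymm.planeVolterra_eqOn laplace_comp hp]
  exact h₁.contDiffAt_and_H0_planeVolterra h₂ hΩ hΩR hΩsymm (L.contDiff.comp_contDiffOn hw) hp

end TransmutationKernel

section Components

variable {a₁ a₂ : ℝ} {χ₁ χ₂ : ℝ → ℝ}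

theorem contDiffAt_of_P {n : WithTop ℕ∞} {w : ℝ × ℝ → ℂ} {p : ℝ × ℝ}
    (h : ∀ i, ContDiffAt ℝ n (P w i) p) : ContDiffAt ℝ n w p := by
  have re_add_im : w = fun q => (P w 1 q : ℂ) + P w 0 q * Complex.I :=
    funext fun q => (Complex.re_add_im (w q)).symm
  rw [re_add_im]
  exact (Complex.ofRealCLM.contDiff.contDiffAt.comp p (h 1)).add
    ((Complex.ofRealCLM.contDiff.contDiffAt.comp p (h 0)).mul contDiffAt_const)

theorem P_bT0_zero (w : ℝ × ℝ → ℂ) : P (bT0 a₁ a₂ χ₁ χ₂ w) 0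
    = planeVolterra (Function.uncurry (kernelKtilde a₁ χ₁)) (Function.uncurry (kernelKtilde a₂ χ₂))
      (Complex.imCLM ∘ w) := by
  funext p
  simp only [P, bT0, Matrix.cons_val_zero, Complex.add_im, Complex.ofReal_im, Complex.I_mul_im,
    Complex.ofReal_re, zero_add]
  rfl

theorem P_bT0_one (w : ℝ × ℝ → ℂ) : P (bT0 a₁ a₂ χ₁ χ₂ w) 1
    = planeVolterra (Function.uncurry (kernelKh a₁ χ₁)) (Function.uncurry (kernelKh a₂ χ₂))
      (Complex.reCLM ∘ w) := by
  funext p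
  simp only [P, bT0, Matrix.cons_val_one, Matrix.cons_val_fin_one, Complex.add_re,
    Complex.ofReal_re, Complex.I_mul_re, Complex.ofReal_im, neg_zero, add_zero]
  rfl

theorem P_bT1_zero (w : ℝ × ℝ → ℂ) : P (bT1 a₁ a₂ χ₁ χ₂ w) 0
    = planeVolterra (Function.uncurry (kernelKh a₁ χ₁)) (Function.uncurry (kernelKtilde a₂ χ₂))
      (Complex.imCLM ∘ w) := by
  funext p
  simp only [P, bT1, Matrix.cons_val_zero, Complex.add_im, Complex.ofReal_im, Complex.I_mul_im,
    Complex.ofReal_re, zero_add]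
  rfl

theorem P_bT1_one (w : ℝ × ℝ → ℂ) : P (bT1 a₁ a₂ χ₁ χ₂ w) 1
    = planeVolterra (Function.uncurry (kernelKtilde a₁ χ₁)) (Function.uncurry (kernelKh a₂ χ₂))
      (Complex.reCLM ∘ w) := by
  funext p
  simp only [P, bT1, Matrix.cons_val_one, Matrix.cons_val_fin_one, Complex.add_re,
    Complex.ofReal_re, Complex.I_mul_re, Complex.ofReal_im, neg_zero, add_zero]
  rfl

theorem H_separable_one (χ₁ χ₂ : ℝ → ℝ) (Ψ : Fin 2 → ℝ × ℝ → ℝ) :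
    H (separable χ₁ χ₂) Ψ 1 = H0 (separable (-χ₁) (-χ₂)) (Ψ 1) :=
  congrFun (H2_separable χ₁ χ₂) (Ψ 1)

theorem H1_separable_zero {Φ : Fin 2 → ℝ × ℝ → ℝ} {p : ℝ × ℝ} (hΦ : ContDiffAt ℝ 2 (Φ 1) p) :
    H1 (separable χ₁ χ₂) Φ 0 p = H0 (separable (-χ₁) χ₂) (Φ 0) p := by
  rw [H1, Fin.sum_univ_two, H1entry_zero_zero, H1entry_zero_one hΦ, add_zero]

theorem H1_separable_one {Φ : Fin 2 → ℝ × ℝ → ℝ} {p : ℝ × ℝ} (hΦ : ContDiffAt ℝ 2 (Φ 0) p) :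
    H1 (separable χ₁ χ₂) Φ 1 p = H0 (separable χ₁ (-χ₂)) (Φ 1) p := by
  rw [H1, Fin.sum_univ_two, H1entry_one_one, H1entry_one_zero hΦ, zero_add]

end Components

section Intertwining

variable {a₁ a₂ : ℝ} {χ₁ χ₂ : ℝ → ℝ} (hχ₁ : ContDiffOn ℝ 2 χ₁ (Ioo (-a₁) a₁))
  (hχ₂ : ContDiffOn ℝ 2 χ₂ (Ioo (-a₂) a₂)) (hχ₁0 : χ₁ 0 = 0) (hχ₂0 : χ₂ 0 = 0)
  {Ω : Set (ℝ × ℝ)} (hΩ : IsOpen Ω) (hΩR : Ω ⊆ Icc (-a₁) a₁ ×ˢ Icc (-a₂) a₂)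
  (hΩsymm : IsRectSymmetric Ω) {w : ℝ × ℝ → ℂ} (hw : ContDiffOn ℝ 2 w Ω) {p : ℝ × ℝ} (hp : p ∈ Ω)

include hχ₁ hχ₂ hχ₁0 hχ₂0 hΩ hΩR hΩsymm hw hp

theorem contDiffAt_bT0_and_H_P_bT0 : ContDiffAt ℝ 2 (bT0 a₁ a₂ χ₁ χ₂ w) p ∧
    ∀ i, H (separable χ₁ χ₂) (P (bT0 a₁ a₂ χ₁ χ₂ w)) i p
      = -P (bT0 a₁ a₂ χ₁ χ₂ (laplace w)) i p := by
  have im := (isTransmutationKernel_kernelKtilde hχ₁ hχ₁0).contDiffAt_and_H0_planeVolterra_clm_comp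
    (isTransmutationKernel_kernelKtilde hχ₂ hχ₂0) hΩ hΩR hΩsymm Complex.imCLM hw hp
  have re := (isTransmutationKernel_neg_kernelKh hχ₁ hχ₁0).contDiffAt_and_H0_planeVolterra_clm_comp
    (isTransmutationKernel_neg_kernelKh hχ₂ hχ₂0) hΩ hΩR hΩsymm Complex.reCLM hw hp
  rw [← P_bT0_zero, ← P_bT0_zero] at im
  rw [← P_bT0_one, ← P_bT0_one] at re
  refine ⟨contDiffAt_of_P (Fin.forall_fin_two.2 ⟨im.1, re.1⟩), Fin.forall_fin_two.2 ⟨im.2, ?_⟩⟩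
  rw [H_separable_one, re.2]

theorem contDiffAt_bT1_and_H1_P_bT1 : ContDiffAt ℝ 2 (bT1 a₁ a₂ χ₁ χ₂ w) p ∧
    ∀ i, H1 (separable χ₁ χ₂) (P (bT1 a₁ a₂ χ₁ χ₂ w)) i p
      = -P (bT1 a₁ a₂ χ₁ χ₂ (laplace w)) i p := by
  have im := (isTransmutationKernel_neg_kernelKh hχ₁ hχ₁0).contDiffAt_and_H0_planeVolterra_clm_comp
    (isTransmutationKernel_kernelKtilde hχ₂ hχ₂0) hΩ hΩR hΩsymm Complex.imCLM hw hp
  have re := (isTransmutationKernel_kernelKtilde hχ₁ hχ₁0).contDiffAt_and_H0_planeVolterra_clm_comp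
    (isTransmutationKernel_neg_kernelKh hχ₂ hχ₂0) hΩ hΩR hΩsymm Complex.reCLM hw hp
  rw [← P_bT1_zero, ← P_bT1_zero] at im
  rw [← P_bT1_one, ← P_bT1_one] at re
  refine ⟨contDiffAt_of_P (Fin.forall_fin_two.2 ⟨im.1, re.1⟩), Fin.forall_fin_two.2 ⟨?_, ?_⟩⟩
  · rw [H1_separable_zero re.1, im.2]
  · rw [H1_separable_one im.1, re.2]

end Intertwining

end SUSY

theorem mainTheorem5_general {a₁ a₂ : ℝ} {χ₁ χ₂ : ℝ → ℝ}
    (hχ₁ : ContDiffOn ℝ 2 χ₁ (Set.Ioo (-a₁) a₁)) (hχ₂ : ContDiffOn ℝ 2 χ₂ (Set.Ioo (-a₂) a₂))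
    (hχ₁0 : χ₁ 0 = 0) (hχ₂0 : χ₂ 0 = 0) {Ω : Set (ℝ × ℝ)} (hΩ : IsOpen Ω)
    (hΩR : Ω ⊆ Set.Icc (-a₁) a₁ ×ˢ Set.Icc (-a₂) a₂) (hΩsymm : SUSY.IsRectSymmetric Ω)
    {w : ℝ × ℝ → ℂ} (hw : ContDiffOn ℝ 2 w Ω) :
    (ContDiffOn ℝ 2 (SUSY.bT0 a₁ a₂ χ₁ χ₂ w) Ω ∧
      ∀ p ∈ Ω, ∀ i : Fin 2,
        SUSY.H (SUSY.separable χ₁ χ₂) (SUSY.P (SUSY.bT0 a₁ a₂ χ₁ χ₂ w)) i p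
          = -SUSY.P (SUSY.bT0 a₁ a₂ χ₁ χ₂ (SUSY.laplace w)) i p) ∧
    (ContDiffOn ℝ 2 (SUSY.bT1 a₁ a₂ χ₁ χ₂ w) Ω ∧
      ∀ p ∈ Ω, ∀ i : Fin 2,
        SUSY.H1 (SUSY.separable χ₁ χ₂) (SUSY.P (SUSY.bT1 a₁ a₂ χ₁ χ₂ w)) i p
          = -SUSY.P (SUSY.bT1 a₁ a₂ χ₁ χ₂ (SUSY.laplace w)) i p) := by
  have bT0_at {p} (hp : p ∈ Ω) :=
    SUSY.contDiffAt_bT0_and_H_P_bT0 hχ₁ hχ₂ hχ₁0 hχ₂0 hΩ hΩR hΩsymm hw hp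
  have bT1_at {p} (hp : p ∈ Ω) :=
    SUSY.contDiffAt_bT1_and_H1_P_bT1 hχ₁ hχ₂ hχ₁0 hχ₂0 hΩ hΩR hΩsymm hw hp
  exact ⟨⟨fun p hp => (bT0_at hp).1.contDiffWithinAt, fun p hp => (bT0_at hp).2⟩,
    fun p hp => (bT1_at hp).1.contDiffWithinAt, fun p hp => (bT1_at hp).2⟩

theorem mainTheorem5 (a₁ a₂ : ℝ) (ha₁ : 0 < a₁) (ha₂ : 0 < a₂) (χ₁ χ₂ : ℝ → ℝ)
    (hχ₁ : ContDiffOn ℝ 2 χ₁ (Set.Ioo (-a₁) a₁)) (hχ₂ : ContDiffOn ℝ 2 χ₂ (Set.Ioo (-a₂) a₂))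
    (hχ₁' : ContDiffOn ℝ 1 χ₁ (Set.Icc (-a₁) a₁)) (hχ₂' : ContDiffOn ℝ 1 χ₂ (Set.Icc (-a₂) a₂))
    (hχ₁0 : χ₁ 0 = 0) (hχ₂0 : χ₂ 0 = 0)
    (Ω : Set (ℝ × ℝ)) (hΩ : IsOpen Ω)
    (hΩR : Ω ⊆ Set.Icc (-a₁) a₁ ×ˢ Set.Icc (-a₂) a₂) (hΩsymm : SUSY.IsRectSymmetric Ω)
    (χ : ℝ × ℝ → ℝ) (hχ : ∀ p, χ p = χ₁ p.1 + χ₂ p.2)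
    (w : ℝ × ℝ → ℂ) (hw : ContDiffOn ℝ 2 w Ω) :
    (ContDiffOn ℝ 2 (SUSY.bT0 a₁ a₂ χ₁ χ₂ w) Ω ∧
      ∀ p ∈ Ω, ∀ i : Fin 2,
        SUSY.H χ (SUSY.P (SUSY.bT0 a₁ a₂ χ₁ χ₂ w)) i p
          = -SUSY.P (SUSY.bT0 a₁ a₂ χ₁ χ₂ (SUSY.laplace w)) i p) ∧
    (ContDiffOn ℝ 2 (SUSY.bT1 a₁ a₂ χ₁ χ₂ w) Ω ∧
      ∀ p ∈ Ω, ∀ i : Fin 2,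
        SUSY.H1 χ (SUSY.P (SUSY.bT1 a₁ a₂ χ₁ χ₂ w)) i p
          = -SUSY.P (SUSY.bT1 a₁ a₂ χ₁ χ₂ (SUSY.laplace w)) i p) := by
  obtain rfl : χ = SUSY.separable χ₁ χ₂ := funext hχ
  exact mainTheorem5_general hχ₁ hχ₂ hχ₁0 hχ₂0 hΩ hΩR hΩsymm hw
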